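/- **Setting.** Consider $N$ agents joined by an undirected graph and partitioned into $G$ groups $\mathcal G_1,\dots,\mathcal G_G$, each nonempty and inducing a connected subgraph. Agent $k$ has neighborhood $\mathcal N_k\ni k$, a cost $J_k:\mathbb R^M\to\mathbb R$ minimized at $w_k^o$, and $w_k^o=w_\ell^o$ whenever $k,\ell$ are in the same group (each group lies in one cluster, a cluster being a set of all agents with a common minimizer). For $k\in\mathcal G_m$, the combination coefficients satisfy $a_{\ell k}>0$ if $\ell\in\mathcal N_k\cap\mathcal G_m$, $a_{\ell k}=0$ otherwise, and $\sum_\ell a_{\ell k}=1$; put $A=[a_{\ell k}]$. Let $p\in\mathbb R^N$ be the vector with $Ap=p$ and $\sum_{k\in\mathcal G_m}p_k=1$ for every $m$. Norms are Euclidean norms of vectors and induced 2-norms of matrices. **Costs.** Each $J_k$ is strictly convex and twice differentiable with $\lambda_{k,L}I\le\nabla^2J_k(w)\le\lambda_{k,U}I$ for all $w$, where $0\le\lambda_{k,L}\le\lambda_{k,U}<\infty$; each group contains an agent with $\lambda_{k,L}>0$; and $\mathcal W=\mathrm{col}\{w_k\}\mapsto\mathrm{diag}\{\nabla^2J_k(w_k)\}$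 is Lipschitz on $\mathbb R^{NM}$. **Noise.** Let $(\mathbb F_i)$ be a filtration on a probability space, and let $\widehat{\nabla J_k}$ at time $i$ be random approximations of $\nabla J_k$ (not depending on the step-sizes). Let $\mathcal S_i(\mathcal W)=\mathrm{col}\{\widehat{\nabla J_k}(w_k)-\nabla J_k(w_k)\}$ and $\mathcal W^o=\mathrm{col}\{w_k^o\}$. For every $i$ and every $\mathbb F_{i-1}$-measurable random $\mathcal W$ with $\mathbb E\|\mathcal W\|^4<\infty$, put $\mathcal R_{s,i}(\mathcal W)=\mathbb E[\mathcal S_i(\mathcal W)\mathcal S_i(\mathcal W)^{\mathsf T}\mid\mathbb F_{i-1}]$ and assume that $\mathcal S_i(\mathcal W)$ is $\mathbb F_i$-measurable and, almost surely, $$\mathbb E[\mathcal S_i(\mathcal W)\mid\mathbb F_{i-1}]=0,\qquad \mathbb E[\|\mathcal S_i(\mathcal W)\|^4\mid\mathbb F_{i-1}]\le\alpha^2\|\mathcal W^o-\mathcal W\|^4+\sigma_s^4,$$ $$\|\mathcal R_{s,i}(\mathcal W^o)-\mathcal R_{s,i}(\mathcal W)\|\le\kappa_s\|\mathcal W^o-\mathcal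 W\|^{\gamma_s},\qquad \mathcal R_{s,i}(\mathcal W^o)\to\mathcal R_s\ \ (i\to\infty),$$ with constants $\alpha,\sigma_s,\kappa_s\ge0$, $0<\gamma_s\le4$, and a symmetric positive definite deterministic matrix $\mathcal R_s$. **Recursions.** For step-sizes $\mu_k>0$ with $\mu_{\max}=\max_k\mu_k$, the diffusion iterates are, for $k\in\mathcal G_m$, $$\psi_{k,i}=w_{k,i-1}-\mu_k\widehat{\nabla J_k}(w_{k,i-1}),\qquad w_{k,i}=\sum_{\ell\in\mathcal N_k\cap\mathcal G_m}a_{\ell k}\psi_{\ell,i},\qquad \mathcal W_i=\mathrm{col}\{w_{k,i}\}.$$ With $\mathcal M=\mathrm{diag}\{\mu_k\}\otimes I_M$, $\mathcal P=\mathrm{diag}\{p_1^g,\dots,p_G^g\}\otimes I_M\in\mathbb R^{NM\times GM}$ (where $p_m^g$ is the block of $p$ on $\mathcal G_m$), $D_m=I_M-\sum_{k\in\mathcal G_m}p_k\mu_k\nabla^2J_k(w_k^o)$ and $\mathcal D=\mathrm{diag}\{D_1,\dots,D_G\}$, the centroid error is $$\widetilde{\mathcal W}_i^{\rm low}=\mathcal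 D\,\widetilde{\mathcal W}_{i-1}^{\rm low}+\mathcal P^{\mathsf T}\mathcal M\,\mathcal S_i(\mathcal W_{i-1}).$$ The initial network vector and the initial centroid error are arbitrary random vectors, measurable with respect to the initial $\sigma$-field, with finite fourth and finite second moment respectively. **Lemma.** For every $\tau>0$ there are $\mu_0>0$ and $C\ge0$ such that, for all step-sizes with $\mu_{\max}\le\mu_0$ and $\mu_k\ge\tau\mu_{\max}>0$ for all $k$, the discrete Lyapunov equation $$\Theta=\mathcal D\Theta\mathcal D+\mathcal P^{\mathsf T}\mathcal M\mathcal R_s\mathcal M\mathcal P$$ has a unique solution $\Theta\in\mathbb R^{GM\times GM}$, it is symmetric and positive definite, and, for all initial conditions as above, $\mathbb E\|\widetilde{\mathcal W}_i^{\rm low}\|^2<\infty$ for every $i$ and $$\limsup_{i\to\infty}\big\|\mathbb E[\widetilde{\mathcal W}_i^{\rm low}(\widetilde{\mathcal W}_i^{\rm low})^{\mathsf T}]-\Theta\big\|\le C\,\mu_{\max}^{1+\gamma_s/2}.$$ -/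

import Mathlib

open Filter Topology MeasureTheory
open scoped Matrix Kronecker Matrix.Norms.L2Operator

noncomputable section

namespace DiffusionNet

/-- Local parameter vectors, with the Euclidean norm. -/
abbrev Vec (M : ℕ) := EuclideanSpace ℝ (Fin M)

/-- Network vectors `col{w_1, …, w_N}`, with the Euclidean norm of `ℝ^{NM}`. -/
abbrev NetVec (N M : ℕ) := PiLp 2 (fun _ : Fin N => Vec M)

/-- A network of `N` agents with `G` groups; every group is nonempty and connected in the
underlying topology. -/
structure Network (N G : ℕ) where
  topology : SimpleGraph (Fin N)
  group : Fin N → Fin G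
  group_connected : ∀ m : Fin G, (topology.induce {k | group k = m}).Connected

open Classical in
/-- The neighbours of agent `k` (itself included) that belong to the group of `k`. -/
def Network.groupNbhd {N G : ℕ} (net : Network N G) (k : Fin N) : Finset (Fin N) :=
  Finset.univ.filter fun l => (l = k ∨ net.topology.Adj l k) ∧ net.group l = net.group k

/-- Convex combination coefficients `a_{lk} = A l k`: positive exactly on the in-group
neighbourhoods, and each column sums to one. -/
structure IsCombination {N G : ℕ} (net : Network N G) (A : Matrix (Fin N) (Fin N) ℝ) : Prop where
  pos : ∀ l k, l ∈ net.groupNbhd k → 0 < A l k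
  zero : ∀ l k, l ∉ net.groupNbhd k → A l k = 0
  sum_one : ∀ k, ∑ l, A l k = 1

/-- `p` stacks the group Perron vectors: since `A` is block diagonal over the groups, `A p = p`
says that each block of `p` is fixed by the corresponding block of `A`; each block of `p` is
normalised to have sum one. -/
structure IsPerron {N G : ℕ} (net : Network N G) (A : Matrix (Fin N) (Fin N) ℝ)
    (p : Fin N → ℝ) : Prop where
  eigen : A *ᵥ p = p
  sum_one : ∀ m : Fin G, ∑ k with net.group k = m, p k = 1

/-- The Hessian matrix of `f` at `w`. -/
def hess {M : ℕ} (f : Vec M → ℝ) (w : Vec M) : Matrix (Fin M) (Fin M) ℝ :=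
  Matrix.of fun a b => fderiv ℝ (gradient f) w (EuclideanSpace.single b 1) a

/-- The block diagonal matrix `diag{B_1, …, B_n}`. -/
def blockDiag {n M : ℕ} (B : Fin n → Matrix (Fin M) (Fin M) ℝ) :
    Matrix (Fin n × Fin M) (Fin n × Fin M) ℝ :=
  Matrix.of fun x y => if x.1 = y.1 then B x.1 x.2 y.2 else 0

/-- Conditions on the individual costs `J k` and their minimizers `wo k`. Agents are in the same
cluster when their minimizers coincide, so `same_cluster` says that a group lies in one cluster. -/
structure CostAssumption {N G M : ℕ} (net : Network N G) (J : Fin N → Vec M → ℝ)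
    (wo : Fin N → Vec M) : Prop where
  minimizer : ∀ k, IsMinOn (J k) Set.univ (wo k)
  same_cluster : ∀ k l, net.group k = net.group l → wo k = wo l
  strictConvex : ∀ k, StrictConvexOn ℝ Set.univ (J k)
  differentiable : ∀ k, Differentiable ℝ (J k)
  twice_differentiable : ∀ k, Differentiable ℝ (gradient (J k))
  hess_bounds : ∃ lamL lamU : Fin N → ℝ,
    (∀ k, 0 ≤ lamL k ∧ lamL k ≤ lamU k) ∧
    (∀ k w, (hess (J k) w - lamL k • (1 : Matrix (Fin M) (Fin M) ℝ)).PosSemidef) ∧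
    (∀ k w, (lamU k • (1 : Matrix (Fin M) (Fin M) ℝ) - hess (J k) w).PosSemidef) ∧
    (∀ m : Fin G, ∃ k, net.group k = m ∧ 0 < lamL k)
  hess_lipschitz : ∃ κH : ℝ, 0 ≤ κH ∧ ∀ W₁ W₂ : NetVec N M,
    ‖blockDiag (fun k => hess (J k) (W₁ k)) - blockDiag (fun k => hess (J k) (W₂ k))‖
      ≤ κH * ‖W₁ - W₂‖

/-- The network vector of minimizers. -/
def netMin {N M : ℕ} (wo : Fin N → Vec M) : NetVec N M := WithLp.toLp 2 wo

/-- The network gradient noise at time `i`, for the gradient approximations `gradHat k i`,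
evaluated at a random network vector `W`:
the `k`-th block is `gradHat k i (W k) - ∇ J k (W k)`. -/
def noise {N M : ℕ} {Ω : Type*} (J : Fin N → Vec M → ℝ)
    (gradHat : Fin N → ℕ → Ω → Vec M → Vec M) (i : ℕ) (W : Ω → NetVec N M) (ω : Ω) :
    NetVec N M :=
  WithLp.toLp 2 fun k => gradHat k i ω (W ω k) - gradient (J k) (W ω k)

/-- The conditional covariance of the network gradient noise at time `n + 1`, evaluated at `W`,
given the information `ℱ n`. -/
def condCov {N M : ℕ} {Ω : Type*} {mΩ : MeasurableSpace Ω} (P : Measure Ω) (ℱ : Filtration ℕ mΩ)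
    (J : Fin N → Vec M → ℝ) (gradHat : Fin N → ℕ → Ω → Vec M → Vec M) (n : ℕ)
    (W : Ω → NetVec N M) (ω : Ω) : Matrix (Fin N × Fin M) (Fin N × Fin M) ℝ :=
  Matrix.of fun x y =>
    (P[fun ω' => noise J gradHat (n + 1) W ω' x.1 x.2 * noise J gradHat (n + 1) W ω' y.1 y.2
      | ℱ n]) ω

/-- Conditions on the gradient noise. The conditions are required only at those
`ℱ n`-measurable random vectors `W` that have a finite fourth moment. -/
structure NoiseAssumption {N M : ℕ} {Ω : Type*} {mΩ : MeasurableSpace Ω} (P : Measure Ω)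
    (ℱ : Filtration ℕ mΩ) (J : Fin N → Vec M → ℝ) (wo : Fin N → Vec M)
    (gradHat : Fin N → ℕ → Ω → Vec M → Vec M) (γ : ℝ)
    (Rs : Matrix (Fin N × Fin M) (Fin N × Fin M) ℝ) : Prop where
  adapted : ∀ (n : ℕ) (W : Ω → NetVec N M), StronglyMeasurable[ℱ n] W → MemLp W 4 P →
    StronglyMeasurable[ℱ (n + 1)] (noise J gradHat (n + 1) W)
  martingale_diff : ∀ (n : ℕ) (W : Ω → NetVec N M), StronglyMeasurable[ℱ n] W → MemLp W 4 P →
    P[noise J gradHat (n + 1) W | ℱ n] =ᵐ[P] 0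
  fourth_moment : ∃ α σ : ℝ, 0 ≤ α ∧ 0 ≤ σ ∧
    ∀ (n : ℕ) (W : Ω → NetVec N M), StronglyMeasurable[ℱ n] W → MemLp W 4 P →
      Integrable (fun ω => ‖noise J gradHat (n + 1) W ω‖ ^ 4) P ∧
      ∀ᵐ ω ∂P, (P[fun ω' => ‖noise J gradHat (n + 1) W ω'‖ ^ 4 | ℱ n]) ω
        ≤ α ^ 2 * ‖netMin wo - W ω‖ ^ 4 + σ ^ 4
  cov_exponent : 0 < γ ∧ γ ≤ 4
  cov_lipschitz : ∃ κ : ℝ, 0 ≤ κ ∧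
    ∀ (n : ℕ) (W : Ω → NetVec N M), StronglyMeasurable[ℱ n] W → MemLp W 4 P →
      ∀ᵐ ω ∂P, ‖condCov P ℱ J gradHat n (fun _ => netMin wo) ω - condCov P ℱ J gradHat n W ω‖
        ≤ κ * ‖netMin wo - W ω‖ ^ γ
  cov_limit : ∀ᵐ ω ∂P, Tendsto
    (fun n => ‖condCov P ℱ J gradHat n (fun _ => netMin wo) ω - Rs‖) atTop (𝓝 0)
  cov_posDef : Rs.PosDef

/-- The diffusion (adapt-then-combine) iterates, over the in-group neighbourhoods. -/
def iterates {N G M : ℕ} {Ω : Type*} (net : Network N G) (A : Matrix (Fin N) (Fin N) ℝ)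
    (gradHat : Fin N → ℕ → Ω → Vec M → Vec M) (μ : Fin N → ℝ) (W₀ : Ω → NetVec N M) :
    ℕ → Ω → NetVec N M
  | 0 => W₀
  | n + 1 => fun ω =>
      let w := iterates net A gradHat μ W₀ n ω
      let ψ : Fin N → Vec M := fun l => w l - μ l • gradHat l (n + 1) ω (w l)
      WithLp.toLp 2 fun k => ∑ l ∈ net.groupNbhd k, A l k • ψ l

/-- The largest step-size. -/
def muMax {N : ℕ} (μ : Fin N → ℝ) : ℝ := ⨆ k, μ k

/-- The matrix `diag{μ_1, …, μ_N} ⊗ I_M`. -/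
def stepMatrix {N : ℕ} (M : ℕ) (μ : Fin N → ℝ) : Matrix (Fin N × Fin M) (Fin N × Fin M) ℝ :=
  Matrix.diagonal μ ⊗ₖ (1 : Matrix (Fin M) (Fin M) ℝ)

/-- The matrix `diag{p_1^g, …, p_G^g} ⊗ I_M`, of size `NM × GM`. -/
def perronMatrix {N G : ℕ} (M : ℕ) (net : Network N G) (p : Fin N → ℝ) :
    Matrix (Fin N × Fin M) (Fin G × Fin M) ℝ :=
  (Matrix.of fun (k : Fin N) (m : Fin G) => if net.group k = m then p k else 0)
    ⊗ₖ (1 : Matrix (Fin M) (Fin M) ℝ)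

/-- The weighted group Hessian `∑_{k in group m} (p_k μ_k / μ_max) ∇²J_k(w_k^o)`. -/
def groupHess {N G M : ℕ} (net : Network N G) (J : Fin N → Vec M → ℝ) (wo : Fin N → Vec M)
    (p μ : Fin N → ℝ) (m : Fin G) : Matrix (Fin M) (Fin M) ℝ :=
  ∑ k with net.group k = m, (p k * μ k / muMax μ) • hess (J k) (wo k)

/-- The coefficient matrix `diag{D_1, …, D_G}`, with `D_m` the identity minus `μ_max` times the
weighted Hessian of group `m`. -/
def lowMatrix {N G M : ℕ} (net : Network N G) (J : Fin N → Vec M → ℝ) (wo : Fin N → Vec M)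
    (p μ : Fin N → ℝ) : Matrix (Fin G × Fin M) (Fin G × Fin M) ℝ :=
  blockDiag fun m => 1 - muMax μ • groupHess net J wo p μ m

/-- The low-dimensional (centroid) error recursion, driven by the gradient noise along the
diffusion iterates. -/
def lowError {N G M : ℕ} {Ω : Type*} (net : Network N G) (A : Matrix (Fin N) (Fin N) ℝ)
    (J : Fin N → Vec M → ℝ) (wo : Fin N → Vec M) (gradHat : Fin N → ℕ → Ω → Vec M → Vec M)
    (p μ : Fin N → ℝ) (W₀ : Ω → NetVec N M) (X₀ : Ω → EuclideanSpace ℝ (Fin G × Fin M)) :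
    ℕ → Ω → EuclideanSpace ℝ (Fin G × Fin M)
  | 0 => X₀
  | n + 1 => fun ω =>
      let x := lowError net A J wo gradHat p μ W₀ X₀ n ω
      let s := noise J gradHat (n + 1) (iterates net A gradHat μ W₀ n) ω
      WithLp.toLp 2
        (lowMatrix net J wo p μ *ᵥ (x : Fin G × Fin M → ℝ)
          + ((perronMatrix M net p)ᵀ * stepMatrix M μ) *ᵥ fun y => s y.1 y.2)

/-- The second-moment matrix `E[X Xᵀ]`. -/
def secondMoment {Ω ι : Type*} [MeasurableSpace Ω] [Fintype ι] (P : Measure Ω)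
    (X : Ω → EuclideanSpace ℝ ι) : Matrix ι ι ℝ :=
  Matrix.of fun x y => ∫ ω, X ω x * X ω y ∂P

/-- `Θ` solves the discrete Lyapunov equation `Θ = D Θ D + Pᵀ M R_s M P`. -/
def IsLyapunov {N G M : ℕ} (net : Network N G) (J : Fin N → Vec M → ℝ) (wo : Fin N → Vec M)
    (p μ : Fin N → ℝ) (Rs : Matrix (Fin N × Fin M) (Fin N × Fin M) ℝ)
    (Θ : Matrix (Fin G × Fin M) (Fin G × Fin M) ℝ) : Prop :=
  Θ = lowMatrix net J wo p μ * Θ * lowMatrix net J wo p μ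
    + (perronMatrix M net p)ᵀ * stepMatrix M μ * Rs * stepMatrix M μ * perronMatrix M net p

end DiffusionNet

end

/-!
Let `t` be the largest step-size. In each group a single agent with `λ_L > 0` contracts, and the
combination step spreads this over the group: perturbing the Perron vector by a multiple of `t`
gives weights for which the weighted fourth moment of the errors contracts at rate `1 - O(t)`. The
perturbation solves a linear system with matrix `1 - A`, solvable because the loss is
redistributed within each group. As the noise has zero conditional mean it adds only `O(t^3)` to
the fourth moment in each step, so `E ‖W - W^o‖^4` settles at `O(t^2)`, and the Lipschitz
condition of exponent `γ` puts the noise covariance within `O(t^(γ/2))` of `R_s`. The noise is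
uncorrelated with the centroid error, so subtracting the Lyapunov equation from the recursion of
the second moments leaves a recursion that contracts at rate `1 - c t` and is driven by
`O(t^2 · t^(γ/2))`; it settles at `O(t^(1 + γ/2))`.
-/

namespace DiffusionNet

section Network

variable {N G : ℕ} {net : Network N G} {A : Matrix (Fin N) (Fin N) ℝ} {p : Fin N → ℝ}

lemma Network.mem_groupNbhd {k l : Fin N} :
    l ∈ net.groupNbhd k ↔ (l = k ∨ net.topology.Adj l k) ∧ net.group l = net.group k := by
  simp only [Network.groupNbhd, Finset.mem_filter, Finset.mem_univ, true_and]

lemma Network.mem_groupNbhd_comm {k l : Fin N} : l ∈ net.groupNbhd k ↔ k ∈ net.groupNbhd l := by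
  rw [mem_groupNbhd, mem_groupNbhd, eq_comm (a := l), net.topology.adj_comm,
    eq_comm (a := net.group l)]

lemma Network.exists_group_eq (net : Network N G) (m : Fin G) : ∃ k, net.group k = m :=
  nonempty_subtype.1 (net.group_connected m).nonempty

lemma Network.group_induction (net : Network N G) {S : Fin N → Prop}
    (spread : ∀ k l, S k → l ∈ net.groupNbhd k → S l) {k l : Fin N} (hk : S k)
    (hkl : net.group l = net.group k) : S l := by
  obtain ⟨walk⟩ := (net.group_connected (net.group k)).preconnected ⟨k, rfl⟩ ⟨l, hkl⟩
  have along_walk : ∀ {u v : {j // net.group j = net.group k}},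
      (net.topology.induce {j | net.group j = net.group k}).Walk u v → S u.1 → S v.1 := by
    intro u v walk
    induction walk with
    | nil => exact id
    | @cons a b _ adj _ ih =>
      exact fun ha => ih (spread _ _ ha (mem_groupNbhd.2
        ⟨Or.inr (SimpleGraph.induce_adj.1 adj).symm, b.2.trans a.2.symm⟩))
  exact along_walk walk hk

lemma IsCombination.nonneg (hA : IsCombination net A) (l k : Fin N) : 0 ≤ A l k := by
  by_cases hl : l ∈ net.groupNbhd k
  · exact (hA.pos l k hl).le
  · exact (hA.zero l k hl).ge

lemma IsCombination.mulVec_nonneg (hA : IsCombination net A) {x : Fin N → ℝ} (hx : ∀ k, 0 ≤ x k)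
    (l : Fin N) : 0 ≤ (A *ᵥ x) l := by
  rw [Matrix.mulVec, dotProduct]
  exact Finset.sum_nonneg fun k _ => mul_nonneg (hA.nonneg l k) (hx k)

lemma IsCombination.sum_groupNbhd (hA : IsCombination net A) {E : Type*} [AddCommGroup E]
    [Module ℝ E] (k : Fin N) (f : Fin N → E) :
    ∑ l ∈ net.groupNbhd k, A l k • f l = ∑ l, A l k • f l :=
  Finset.sum_subset (Finset.subset_univ _) fun l _ hl => by rw [hA.zero l k hl, zero_smul]

lemma IsCombination.sum_mulVec (hA : IsCombination net A) (x : Fin N → ℝ) :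
    ∑ l, (A *ᵥ x) l = ∑ k, x k := by
  have one_vecMul : 1 ᵥ* A = 1 := funext fun k => by simp [Matrix.vecMul, dotProduct, hA.sum_one]
  rw [← one_dotProduct, Matrix.dotProduct_mulVec, one_vecMul, one_dotProduct]

lemma IsCombination.eq_of_vecMul_eq_of_le (hA : IsCombination net A) {v : Fin N → ℝ}
    (hv : v ᵥ* A = v) {j : Fin N} (hle : ∀ i ∈ net.groupNbhd j, v i ≤ v j) {i : Fin N}
    (hi : i ∈ net.groupNbhd j) : v i = v j := by
  have sum_gap : ∑ x, (v j - v x) * A x j = 0 := by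
    have hvj : ∑ x, v x * A x j = v j := congrFun hv j
    simp only [sub_mul, Finset.sum_sub_distrib, ← Finset.mul_sum, hA.sum_one, mul_one, hvj,
      sub_self]
  have gap_nonneg : ∀ x ∈ Finset.univ, 0 ≤ (v j - v x) * A x j := by
    intro x _
    by_cases hx : x ∈ net.groupNbhd j
    · exact mul_nonneg (sub_nonneg.2 (hle x hx)) (hA.nonneg _ _)
    · rw [hA.zero x j hx, mul_zero]
  have gap_eq_zero := (Finset.sum_eq_zero_iff_of_nonneg gap_nonneg).1 sum_gap i (Finset.mem_univ i)
  exact (sub_eq_zero.1 ((mul_eq_zero.1 gap_eq_zero).resolve_right (hA.pos i j hi).ne')).symm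

lemma IsCombination.eq_of_vecMul_eq (hA : IsCombination net A) {v : Fin N → ℝ}
    (hv : v ᵥ* A = v) {k l : Fin N} (hkl : net.group k = net.group l) : v k = v l := by
  obtain ⟨top, htop, hmax⟩ := Finset.exists_max_image
    (Finset.univ.filter fun j => net.group j = net.group l) v ⟨l, by simp⟩
  simp only [Finset.mem_filter, Finset.mem_univ, true_and] at htop hmax
  have spread : ∀ j i, v j = v top ∧ net.group j = net.group l → i ∈ net.groupNbhd j →
      v i = v top ∧ net.group i = net.group l := by
    rintro j i ⟨hj, hjl⟩ hi
    refine ⟨?_, (Network.mem_groupNbhd.1 hi).2.trans hjl⟩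
    rw [← hj]
    exact hA.eq_of_vecMul_eq_of_le hv
      (fun x hx => hj ▸ hmax x ((Network.mem_groupNbhd.1 hx).2.trans hjl)) hi
  have eq_top : ∀ i, net.group i = net.group l → v i = v top := fun i hi =>
    (net.group_induction spread ⟨rfl, htop⟩ (hi.trans htop.symm)).1
  exact (eq_top k hkl).trans (eq_top l rfl).symm

lemma IsCombination.mulVec_abs_eq (hA : IsCombination net A) {x : Fin N → ℝ} (hx : A *ᵥ x = x) :
    A *ᵥ |x| = |x| := by
  have abs_le : ∀ l ∈ Finset.univ, |x| l ≤ (A *ᵥ |x|) l := by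
    intro l _
    calc |x l| = |∑ k, A l k * x k| := congrArg _ (congrFun hx l).symm
      _ ≤ ∑ k, |A l k * x k| := Finset.abs_sum_le_sum_abs _ _
      _ = (A *ᵥ |x|) l := by
        simp only [Matrix.mulVec, dotProduct, abs_mul, abs_of_nonneg (hA.nonneg _ _), Pi.abs_apply]
  exact funext fun l =>
    ((Finset.sum_eq_sum_iff_of_le abs_le).1 (hA.sum_mulVec _).symm l (Finset.mem_univ l)).symm

lemma IsCombination.eq_zero_of_mulVec_eq (hA : IsCombination net A) {x : Fin N → ℝ}
    (hx : A *ᵥ x = x) (hx0 : 0 ≤ x) {k l : Fin N} (hl : x l = 0)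
    (hkl : net.group k = net.group l) : x k = 0 := by
  refine net.group_induction (S := fun j => x j = 0) (fun j i hj hi => ?_) hl hkl
  have sum_eq_zero : ∑ k, A j k * x k = 0 := (congrFun hx j).trans hj
  have term_eq_zero := (Finset.sum_eq_zero_iff_of_nonneg
    fun k _ => mul_nonneg (hA.nonneg j k) (hx0 k)).1 sum_eq_zero i (Finset.mem_univ i)
  exact (mul_eq_zero.1 term_eq_zero).resolve_left
    (hA.pos j i (Network.mem_groupNbhd_comm.1 hi)).ne'

lemma IsPerron.pos (hA : IsCombination net A) (hp : IsPerron net A p) (l : Fin N) : 0 < p l := by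
  by_contra! hl
  have fixed : A *ᵥ (|p| + p) = |p| + p := by
    rw [Matrix.mulVec_add, hA.mulVec_abs_eq hp.eigen, hp.eigen]
  have nonneg : 0 ≤ |p| + p := fun k => by
    simpa using neg_le_iff_add_nonneg'.1 (neg_abs_le (p k))
  have zero_at : (|p| + p) l = 0 := by simp [abs_of_nonpos hl]
  have nonpos_on_group : ∀ k, net.group k = net.group l → p k ≤ 0 := fun k hk => by
    have := hA.eq_zero_of_mulVec_eq fixed nonneg zero_at hk
    simp only [Pi.add_apply, Pi.abs_apply] at this
    linarith [abs_nonneg (p k)]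
  have sum_nonpos : ∑ k with net.group k = net.group l, p k ≤ 0 :=
    Finset.sum_nonpos fun k hk => nonpos_on_group k (Finset.mem_filter.1 hk).2
  linarith [hp.sum_one (net.group l)]

/- A functional vanishing on the range of `1 - A` is a left fixed vector of `A`, hence constant on
groups, so it annihilates `h`. -/
lemma IsCombination.exists_sub_mulVec_eq (hA : IsCombination net A) {h : Fin N → ℝ}
    (hsum : ∀ m : Fin G, ∑ k with net.group k = m, h k = 0) : ∃ r : Fin N → ℝ, r - A *ᵥ r = h := by
  suffices h ∈ LinearMap.range (Matrix.mulVecLin (1 - A)) by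
    obtain ⟨r, hr⟩ := this
    exact ⟨r, by rw [← hr, Matrix.mulVecLin_apply, Matrix.sub_mulVec, Matrix.one_mulVec]⟩
  by_contra h_notMem
  obtain ⟨f, hfh, hf⟩ := Submodule.exists_le_ker_of_notMem h_notMem
  obtain ⟨v, rfl⟩ := (dotProductEquiv ℝ (Fin N)).surjective f
  have left_fixed : v ᵥ* A = v := by
    have annihilates : ∀ x, v ⬝ᵥ (x - A *ᵥ x) = 0 := fun x => by
      simpa [Matrix.sub_mulVec] using hf ⟨x, rfl⟩
    refine (dotProduct_eq _ _ fun x => ?_)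
    rw [← Matrix.dotProduct_mulVec, ← sub_eq_zero, ← neg_eq_zero, neg_sub, ← dotProduct_sub,
      annihilates]
  refine hfh ?_
  change ∑ k, v k * h k = 0
  rw [← Finset.sum_fiberwise _ net.group]
  refine Finset.sum_eq_zero fun m _ => ?_
  obtain ⟨k, rfl⟩ := net.exists_group_eq m
  calc ∑ x with net.group x = net.group k, v x * h x
      = ∑ x with net.group x = net.group k, v k * h x := Finset.sum_congr rfl fun x hx => by
        rw [hA.eq_of_vecMul_eq left_fixed (Finset.mem_filter.1 hx).2]
    _ = 0 := by rw [← Finset.mul_sum, hsum, mul_zero]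

lemma eventually_lt_nhdsGT_zero {f : ℝ → ℝ} {c : ℝ} (hf : Continuous f) (hc : f 0 < c) :
    ∀ᶠ t in 𝓝[>] (0 : ℝ), f t < c :=
  nhdsWithin_le_nhds (hf.continuousAt.eventually_lt_const hc)

lemma exists_pos_forall_lt {ι : Type*} [Finite ι] {f : ι → ℝ} (hf : ∀ i, 0 < f i) :
    ∃ c > 0, ∀ i, c < f i :=
  let ⟨c, hlt, hpos⟩ := ((eventually_all.2 fun i => Ioo_mem_nhdsGT (hf i)).and
    self_mem_nhdsWithin).exists (f := 𝓝[>] (0 : ℝ))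
  ⟨c, hpos, fun i => (hlt i).2⟩

/- First-order perturbation of the Perron vector: `r` is chosen so that, to first order in `t`, the
loss `lam l * p l` at the single agents is redistributed evenly over their group. -/
lemma IsPerron.exists_contracting_direction (hA : IsCombination net A) (hp : IsPerron net A p)
    {lam : Fin N → ℝ} (hlam : ∀ k, 0 ≤ lam k)
    (hgroup : ∀ m : Fin G, ∃ k, net.group k = m ∧ 0 < lam k) :
    ∃ δ > 0, ∃ r : Fin N → ℝ, ∀ᶠ t in 𝓝[>] (0 : ℝ), ∀ l,
      (A *ᵥ (p + t • r)) l * (1 - t * lam l) ≤ (1 - δ * t) * (p + t • r) l := by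
  set c : Fin G → ℝ := fun m => ∑ k with net.group k = m, lam k * p k
  have c_pos : ∀ m, 0 < c m := by
    intro m
    obtain ⟨k, hk, hlamk⟩ := hgroup m
    exact Finset.sum_pos' (fun j _ => mul_nonneg (hlam j) (hp.pos hA j).le)
      ⟨k, by simp [hk], mul_pos hlamk (hp.pos hA k)⟩
  obtain ⟨r, hr⟩ := hA.exists_sub_mulVec_eq
    (h := fun l => c (net.group l) * p l - lam l * p l) fun m => by
      have : ∑ k with net.group k = m, c (net.group k) * p k = c m := by
        rw [Finset.sum_congr rfl fun k hk => by rw [(Finset.mem_filter.1 hk).2],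
          ← Finset.mul_sum, hp.sum_one, mul_one]
      rw [Finset.sum_sub_distrib, this, sub_self]
  obtain ⟨δ, hδ, hδc⟩ := exists_pos_forall_lt c_pos
  refine ⟨δ, hδ, r, ?_⟩
  have remainder_small : ∀ᶠ t in 𝓝[>] (0 : ℝ), ∀ l,
      t * (δ * r l - lam l * (A *ᵥ r) l) < (c (net.group l) - δ) * p l :=
    eventually_all.2 fun l => eventually_lt_nhdsGT_zero (by fun_prop) <| by
      simpa using mul_pos (sub_pos.2 (hδc (net.group l))) (hp.pos hA l)
  filter_upwards [remainder_small, self_mem_nhdsWithin] with t remainder_lt (ht : 0 < t) l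
  have mulVec_eq : (A *ᵥ (p + t • r)) l = p l + t * (A *ᵥ r) l := by
    simp [Matrix.mulVec_add, Matrix.mulVec_smul, hp.eigen]
  have hrl : r l - (A *ᵥ r) l = c (net.group l) * p l - lam l * p l := congrFun hr l
  rw [mulVec_eq, Pi.add_apply, Pi.smul_apply, smul_eq_mul]
  linear_combination t * remainder_lt l - t * hrl

end Network

section Matrix

lemma posSemidef_sum_sub_smul_one {n ι : Type*} [DecidableEq n] (s : Finset ι)
    {H : ι → Matrix n n ℝ} {q lam : ι → ℝ} {c : ℝ} (hq : ∀ k ∈ s, 0 ≤ q k)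
    (hH : ∀ k ∈ s, (H k - lam k • (1 : Matrix n n ℝ)).PosSemidef)
    (hc : c ≤ ∑ k ∈ s, q k * lam k) :
    (∑ k ∈ s, q k • H k - c • (1 : Matrix n n ℝ)).PosSemidef := by
  have excess := (Matrix.posSemidef_sum s fun k hk => (hH k hk).smul (hq k hk)).add
    ((Matrix.PosSemidef.one (n := n) (R := ℝ)).smul (sub_nonneg.2 hc))
  convert excess using 1
  simp only [smul_sub, smul_smul, Finset.sum_sub_distrib, ← Finset.sum_smul, sub_smul]
  abel

variable {m n : Type*} [Fintype m] [Fintype n]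

lemma l2_opNorm_transpose [DecidableEq m] [DecidableEq n] (B : Matrix m n ℝ) : ‖Bᵀ‖ = ‖B‖ := by
  rw [← Matrix.conjTranspose_eq_transpose_of_trivial, Matrix.l2_opNorm_conjTranspose]

lemma norm_mul_mul_transpose_le [DecidableEq m] [DecidableEq n] (D : Matrix m n ℝ)
    (S : Matrix n n ℝ) : ‖D * S * Dᵀ‖ ≤ ‖D‖ ^ 2 * ‖S‖ := by
  calc ‖D * S * Dᵀ‖ ≤ ‖D‖ * ‖S‖ * ‖Dᵀ‖ := (Matrix.l2_opNorm_mul _ _).trans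
        (mul_le_mul_of_nonneg_right (Matrix.l2_opNorm_mul _ _) (norm_nonneg _))
    _ = ‖D‖ ^ 2 * ‖S‖ := by rw [l2_opNorm_transpose]; ring

lemma l2_opNorm_le_of_posSemidef [DecidableEq n] {T : Matrix n n ℝ} {c : ℝ} (hc : 0 ≤ c)
    (hT : T.PosSemidef) (hTc : (c • (1 : Matrix n n ℝ) - T).PosSemidef) : ‖T‖ ≤ c := by
  have symmetric : ((Matrix.toEuclideanCLM (n := n) (𝕜 := ℝ) T) :
      EuclideanSpace ℝ n →ₗ[ℝ] EuclideanSpace ℝ n).IsSymmetric :=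
    Matrix.isSymmetric_toEuclideanLin_iff.2 hT.1
  rw [Matrix.cstar_norm_def,
    ContinuousLinearMap.norm_eq_iSup_rayleighQuotient _ symmetric]
  refine Real.iSup_le (fun x => ?_) hc
  have quadratic_eq : (Matrix.toEuclideanCLM (n := n) (𝕜 := ℝ) T).reApplyInnerSelf x
      = x.ofLp ⬝ᵥ T *ᵥ x.ofLp := rfl
  have quadratic_nonneg : 0 ≤ x.ofLp ⬝ᵥ T *ᵥ x.ofLp := by
    simpa using hT.dotProduct_mulVec_nonneg x.ofLp
  have quadratic_le : x.ofLp ⬝ᵥ T *ᵥ x.ofLp ≤ c * ‖x‖ ^ 2 := by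
    have := hTc.dotProduct_mulVec_nonneg x.ofLp
    rw [star_trivial, Matrix.sub_mulVec, dotProduct_sub, Matrix.smul_mulVec, Matrix.one_mulVec,
      dotProduct_smul, smul_eq_mul, sub_nonneg] at this
    rw [EuclideanSpace.real_norm_sq_eq]
    simpa only [dotProduct, sq] using this
  rw [ContinuousLinearMap.rayleighQuotient, quadratic_eq, abs_of_nonneg (by positivity)]
  exact div_le_of_le_mul₀ (by positivity) hc quadratic_le

lemma dotProduct_blockDiag_mulVec {N M : ℕ} (B : Fin N → Matrix (Fin M) (Fin M) ℝ)
    (x : Fin N × Fin M → ℝ) :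
    x ⬝ᵥ blockDiag B *ᵥ x = ∑ k, (fun a => x (k, a)) ⬝ᵥ B k *ᵥ fun a => x (k, a) := by
  simp [dotProduct, Matrix.mulVec, blockDiag, Fintype.sum_prod_type]

lemma transpose_blockDiag {N M : ℕ} (B : Fin N → Matrix (Fin M) (Fin M) ℝ) :
    (blockDiag B)ᵀ = blockDiag fun k => (B k)ᵀ := by
  ext ⟨k, a⟩ ⟨l, b⟩
  rcases eq_or_ne k l with rfl | hkl
  · simp [blockDiag]
  · simp [blockDiag, hkl, hkl.symm]

lemma blockDiag_sub {N M : ℕ} (B C : Fin N → Matrix (Fin M) (Fin M) ℝ) :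
    blockDiag (B - C) = blockDiag B - blockDiag C := by
  ext x y
  by_cases hxy : x.1 = y.1 <;> simp [blockDiag, hxy]

lemma blockDiag_const_smul_one {N M : ℕ} (c : ℝ) :
    blockDiag (fun _ : Fin N => c • (1 : Matrix (Fin M) (Fin M) ℝ)) = c • 1 := by
  ext ⟨k, a⟩ ⟨l, b⟩
  by_cases hkl : k = l <;> by_cases hab : a = b <;> simp [blockDiag, hkl, hab]

lemma posSemidef_blockDiag {N M : ℕ} {B : Fin N → Matrix (Fin M) (Fin M) ℝ}
    (hB : ∀ k, (B k).PosSemidef) : (blockDiag B).PosSemidef := by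
  refine .of_dotProduct_mulVec_nonneg ?_ fun x => ?_
  · rw [Matrix.IsHermitian, Matrix.conjTranspose_eq_transpose_of_trivial, transpose_blockDiag]
    exact congrArg blockDiag <| funext fun k => by
      rw [← Matrix.conjTranspose_eq_transpose_of_trivial, (hB k).1]
  · rw [star_trivial, dotProduct_blockDiag_mulVec]
    exact Finset.sum_nonneg fun k _ => by
      simpa using (hB k).dotProduct_mulVec_nonneg fun a => x (k, a)

end Matrix

section Stein

lemma existsUnique_eq_mul_mul_add {R : Type*} [NormedRing R] [CompleteSpace R] {a b : R}
    (ha : ‖a‖ < 1) (hb : ‖b‖ < 1) (q : R) : ∃! x, x = a * x * b + q := by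
  have contracting : ContractingWith (‖a‖₊ * ‖b‖₊) fun x => a * x * b + q := by
    refine ⟨mul_lt_one_of_nonneg_of_lt_one_left zero_le ha (le_of_lt hb),
      LipschitzWith.of_dist_le_mul fun x y => ?_⟩
    rw [dist_add_right, dist_eq_norm, dist_eq_norm, ← sub_mul, ← mul_sub]
    calc ‖a * (x - y) * b‖ ≤ ‖a‖ * ‖x - y‖ * ‖b‖ :=
          (norm_mul_le _ _).trans (by gcongr; exact norm_mul_le _ _)
      _ = ‖a‖ * ‖b‖ * ‖x - y‖ := by ring
  exact ⟨_, contracting.fixedPoint_isFixedPt.symm, fun y hy =>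
    contracting.fixedPoint_unique hy.symm⟩

variable {n : Type*} [Fintype n] [DecidableEq n] {D Q Θ : Matrix n n ℝ}

lemma existsUnique_stein (hD : ‖D‖ < 1) (Q : Matrix n n ℝ) : ∃! Θ, Θ = D * Θ * D + Q :=
  have : CompleteSpace (Matrix n n ℝ) := FiniteDimensional.complete ℝ _
  existsUnique_eq_mul_mul_add hD hD Q

lemma isSymm_of_stein (hD : ‖D‖ < 1) (hDs : D.IsSymm) (hQ : Q.IsSymm)
    (hΘ : Θ = D * Θ * D + Q) : Θ.IsSymm := by
  refine (existsUnique_stein hD Q).unique ?_ hΘ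
  nth_rewrite 1 [hΘ]
  rw [Matrix.transpose_add, Matrix.transpose_mul, Matrix.transpose_mul, hDs.eq, hQ.eq, mul_assoc]

/- The quadratic form of `Θ` decreases along `x, D x, D² x, …`, which tends to `0`. -/
lemma dotProduct_mulVec_nonneg_of_stein (hD : ‖D‖ < 1) (hDs : D.IsSymm) (hQ : Q.PosSemidef)
    (hΘ : Θ = D * Θ * D + Q) (x : n → ℝ) : 0 ≤ x ⬝ᵥ Θ *ᵥ x := by
  have decrease : ∀ i : ℕ, x ⬝ᵥ (D ^ i * Θ * D ^ i) *ᵥ x ≤ x ⬝ᵥ Θ *ᵥ x := by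
    intro i
    induction i with
    | zero => simp
    | succ i ih =>
      have split : D ^ i * Θ * D ^ i = D ^ (i + 1) * Θ * D ^ (i + 1) + D ^ i * Q * D ^ i := by
        nth_rewrite 1 [hΘ]
        rw [pow_succ, mul_add, add_mul]
        simp only [mul_assoc, (Commute.refl D).pow_right i |>.eq]
      have nonneg := (hQ.conjTranspose_mul_mul_same (D ^ i)).dotProduct_mulVec_nonneg x
      rw [Matrix.conjTranspose_eq_transpose_of_trivial, Matrix.transpose_pow, hDs.eq,
        star_trivial] at nonneg
      rw [split, Matrix.add_mulVec, dotProduct_add] at ih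
      linarith
  have limit : Tendsto (fun i : ℕ => x ⬝ᵥ (D ^ i * Θ * D ^ i) *ᵥ x) atTop (𝓝 0) := by
    have continuous : Continuous fun E : Matrix n n ℝ => x ⬝ᵥ (E * Θ * E) *ᵥ x := by fun_prop
    simpa [Function.comp_def] using
      (continuous.tendsto 0).comp (tendsto_pow_atTop_nhds_zero_of_norm_lt_one hD)
  exact le_of_tendsto' limit decrease

lemma posDef_of_stein (hD : ‖D‖ < 1) (hDs : D.IsSymm) (hQ : Q.PosDef)
    (hΘ : Θ = D * Θ * D + Q) : Θ.PosDef := by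
  have quadratic_nonneg := dotProduct_mulVec_nonneg_of_stein hD hDs hQ.posSemidef hΘ
  have posSemidef : Θ.PosSemidef := .of_dotProduct_mulVec_nonneg
    (Matrix.isHermitian_iff_isSymm.2
      (isSymm_of_stein hD hDs (Matrix.isHermitian_iff_isSymm.1 hQ.1) hΘ))
    (by simpa using quadratic_nonneg)
  have conj_posSemidef : (D * Θ * D).PosSemidef := by
    simpa [hDs.eq] using posSemidef.conjTranspose_mul_mul_same D
  rw [hΘ]
  exact .posSemidef_add conj_posSemidef hQ

end Stein

section Gradient

variable {M : ℕ} {f : Vec M → ℝ}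

lemma fderiv_gradient_eq (w : Vec M) :
    fderiv ℝ (gradient f) w = Matrix.toEuclideanCLM (n := Fin M) (𝕜 := ℝ) (hess f w) := by
  apply ContinuousLinearMap.coe_injective
  refine (EuclideanSpace.basisFun (Fin M) ℝ).toBasis.ext fun b => ?_
  ext a
  simp [hess]

lemma norm_id_sub_smul_fderiv_gradient_le {a b μ : ℝ} {w : Vec M}
    (lower : (hess f w - a • (1 : Matrix (Fin M) (Fin M) ℝ)).PosSemidef)
    (upper : (b • (1 : Matrix (Fin M) (Fin M) ℝ) - hess f w).PosSemidef)
    (hab : a ≤ b) (hμ : 0 ≤ μ) (hμb : μ * b ≤ 1) :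
    ‖ContinuousLinearMap.id ℝ (Vec M) - μ • fderiv ℝ (gradient f) w‖ ≤ 1 - μ * a := by
  have eq_toEuclideanCLM : ContinuousLinearMap.id ℝ (Vec M) - μ • fderiv ℝ (gradient f) w
      = Matrix.toEuclideanCLM (n := Fin M) (𝕜 := ℝ) (1 - μ • hess f w) := by
    rw [fderiv_gradient_eq, map_sub, map_smul, map_one]
    rfl
  rw [eq_toEuclideanCLM, ← Matrix.cstar_norm_def]
  refine l2_opNorm_le_of_posSemidef (sub_nonneg.2 ((by gcongr : μ * a ≤ μ * b).trans hμb)) ?_ ?_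
  · convert (upper.smul hμ).add (Matrix.PosSemidef.one.smul (sub_nonneg.2 hμb)) using 1
    module
  · convert lower.smul hμ using 1
    module

lemma norm_gradient_step_sub_le (hf : Differentiable ℝ (gradient f)) {a b μ : ℝ}
    (lower : ∀ w, (hess f w - a • (1 : Matrix (Fin M) (Fin M) ℝ)).PosSemidef)
    (upper : ∀ w, (b • (1 : Matrix (Fin M) (Fin M) ℝ) - hess f w).PosSemidef)
    (hab : a ≤ b) (hμ : 0 ≤ μ) (hμb : μ * b ≤ 1) (w w' : Vec M) :
    ‖(w - μ • gradient f w) - (w' - μ • gradient f w')‖ ≤ (1 - μ * a) * ‖w - w'‖ := by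
  have hasFDerivAt : ∀ v, HasFDerivAt (fun w => w - μ • gradient f w)
      (ContinuousLinearMap.id ℝ _ - μ • fderiv ℝ (gradient f) v) v := fun v =>
    (hasFDerivAt_id v).sub ((hf v).hasFDerivAt.const_smul μ)
  exact convex_univ.norm_image_sub_le_of_norm_hasFDerivWithin_le
    (fun v _ => (hasFDerivAt v).hasFDerivWithinAt)
    (fun v _ => norm_id_sub_smul_fderiv_gradient_le (lower v) (upper v) hab hμ hμb)
    (Set.mem_univ w') (Set.mem_univ w)

lemma gradient_eq_zero_of_isMinOn {w : Vec M} (hw : IsMinOn f Set.univ w) : gradient f w = 0 := by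
  rw [gradient, (hw.isLocalMin univ_mem).fderiv_eq_zero, map_zero]

end Gradient

lemma eventually_lt_of_le_mul_add {a : ℕ → ℝ} {ρ b c : ℝ} (hρ : 0 ≤ ρ) (hρ1 : ρ < 1)
    (hc : b / (1 - ρ) < c) (step : ∀ᶠ n in atTop, a (n + 1) ≤ ρ * a n + b) :
    ∀ᶠ n in atTop, a n < c := by
  obtain ⟨n₀, step⟩ := eventually_atTop.1 step
  have fixed_point : ρ * (b / (1 - ρ)) + b = b / (1 - ρ) := by
    field_simp [(sub_pos.2 hρ1).ne']
    ring
  have geometric (k : ℕ) : a (k + n₀) - b / (1 - ρ) ≤ ρ ^ k * (a n₀ - b / (1 - ρ)) := by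
    simpa using le_geom (u := fun k => a (k + n₀) - b / (1 - ρ)) hρ k fun j _ => by
      have := step (j + n₀) (Nat.le_add_left _ _)
      rw [add_right_comm] at this
      linear_combination this + fixed_point
  have limit : Tendsto (fun k => ρ ^ k * (a n₀ - b / (1 - ρ)) + b / (1 - ρ)) atTop
      (𝓝 (b / (1 - ρ))) := by
    simpa using ((tendsto_pow_atTop_nhds_zero_of_lt_one hρ hρ1).mul_const _).add_const _
  rw [← map_add_atTop_eq_nat n₀, eventually_map]
  filter_upwards [limit.eventually_lt_const hc] with k hk
  exact (sub_le_iff_le_add.1 (geometric k)).trans_lt hk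

section FourthPower

variable {E : Type*} [NormedAddCommGroup E] [InnerProductSpace ℝ E]

lemma norm_sub_pow_four_le (x s : E) {η : ℝ} (hη : 0 < η) :
    ‖x - s‖ ^ 4 ≤ (1 + η) * ‖x‖ ^ 4 - 4 * inner ℝ (‖x‖ ^ 2 • x) s
      + (16 / η + 3) * ‖s‖ ^ 4 := by
  have expand : ‖x - s‖ ^ 4 = (‖x‖ ^ 2 - 2 * inner ℝ x s + ‖s‖ ^ 2) ^ 2 := by
    rw [← norm_sub_sq_real, ← pow_mul]
  have cauchy_schwarz : inner ℝ x s ^ 2 ≤ (‖x‖ * ‖s‖) ^ 2 :=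
    sq_le_sq' (abs_le.1 (abs_real_inner_le_norm x s)).1 (abs_le.1 (abs_real_inner_le_norm x s)).2
  have young : 8 * ‖x‖ ^ 2 * ‖s‖ ^ 2 ≤ η * ‖x‖ ^ 4 + 16 / η * ‖s‖ ^ 4 := by
    have square : η * ‖x‖ ^ 4 + 16 / η * ‖s‖ ^ 4 - 8 * ‖x‖ ^ 2 * ‖s‖ ^ 2
        = (η * ‖x‖ ^ 2 - 4 * ‖s‖ ^ 2) ^ 2 / η := by field_simp; ring
    linarith [div_nonneg (sq_nonneg (η * ‖x‖ ^ 2 - 4 * ‖s‖ ^ 2)) hη.le]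
  rw [expand, real_inner_smul_left]
  linear_combination 6 * cauchy_schwarz + young + 2 * sq_nonneg (inner ℝ x s + ‖s‖ ^ 2)

lemma abs_inner_norm_sq_smul_le (x s : E) :
    |inner ℝ (‖x‖ ^ 2 • x) s| ≤ ‖x‖ ^ 4 + ‖s‖ ^ 4 := by
  calc |inner ℝ (‖x‖ ^ 2 • x) s| ≤ ‖‖x‖ ^ 2 • x‖ * ‖s‖ := abs_real_inner_le_norm _ _
    _ = ‖x‖ ^ 3 * ‖s‖ := by rw [norm_smul, norm_pow, norm_norm]; ring
    _ ≤ ‖x‖ ^ 4 + ‖s‖ ^ 4 := by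
      nlinarith [mul_nonneg (sq_nonneg ‖x‖) (sq_nonneg (‖x‖ - ‖s‖)),
        sq_nonneg (‖x‖ ^ 2 - ‖s‖ ^ 2), sq_nonneg (‖x‖ ^ 2), sq_nonneg (‖s‖ ^ 2)]

lemma norm_sum_smul_pow_le {E ι : Type*} [SeminormedAddCommGroup E] [NormedSpace ℝ E] [Fintype ι]
    {a : ι → ℝ} (ha : ∀ i, 0 ≤ a i) (ha1 : ∑ i, a i = 1) (y : ι → E) (r : ℕ) :
    ‖∑ i, a i • y i‖ ^ r ≤ ∑ i, a i * ‖y i‖ ^ r :=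
  calc ‖∑ i, a i • y i‖ ^ r ≤ (∑ i, a i * ‖y i‖) ^ r := by
        gcongr
        exact norm_sum_le_of_le _ fun i _ => by rw [norm_smul, Real.norm_of_nonneg (ha i)]
    _ ≤ ∑ i, a i * ‖y i‖ ^ r :=
      Real.pow_arith_mean_le_arith_mean_pow _ _ _ (fun i _ => ha i) ha1
        (fun i _ => norm_nonneg _) r

lemma norm_pow_four_le_sum {ι : Type*} [Fintype ι] {β : ι → Type*}
    [∀ i, SeminormedAddCommGroup (β i)] (x : PiLp 2 β) {q : ι → ℝ} (hq : ∀ i, 0 < q i) :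
    ‖x‖ ^ 4 ≤ (∑ i, (q i)⁻¹) * ∑ i, q i * ‖x i‖ ^ 4 := by
  rw [show ‖x‖ ^ 4 = (∑ i, ‖x i‖ ^ 2) ^ 2 by rw [← PiLp.norm_sq_eq_of_L2, ← pow_mul]]
  refine Finset.sum_sq_le_sum_mul_sum_of_sq_le_mul _ (fun i _ => (inv_pos.2 (hq i)).le)
    (fun i _ => mul_nonneg (hq i).le (by positivity)) fun i _ => le_of_eq ?_
  rw [inv_mul_cancel_left₀ (hq i).ne']
  ring

end FourthPower

section FourthMoment

variable {Ω : Type*} {m mΩ : MeasurableSpace Ω} {P : Measure Ω}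

lemma memLp_four_iff_integrable {E : Type*} [NormedAddCommGroup E] {f : Ω → E}
    (hf : AEStronglyMeasurable f P) : MemLp f 4 P ↔ Integrable (fun ω => ‖f ω‖ ^ 4) P := by
  rw [← integrable_norm_rpow_iff hf (by norm_num) (by norm_num)]
  have exponent : (4 : ENNReal).toReal = ((4 : ℕ) : ℝ) := by norm_num
  simp_rw [exponent, Real.rpow_natCast]

lemma integral_bilin_eq_zero_of_condExp_eq_zero [IsFiniteMeasure P] (hm : m ≤ mΩ)
    {E F K : Type*} [NormedAddCommGroup E] [NormedSpace ℝ E] [CompleteSpace E]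
    [NormedAddCommGroup F] [NormedSpace ℝ F] [NormedAddCommGroup K] [NormedSpace ℝ K]
    [CompleteSpace K] (B : F →L[ℝ] E →L[ℝ] K) {f : Ω → F} {g : Ω → E}
    (hf : StronglyMeasurable[m] f) (hfg : Integrable (fun ω => B (f ω) (g ω)) P)
    (hg : Integrable g P) (hg0 : P[g | m] =ᵐ[P] 0) : ∫ ω, B (f ω) (g ω) ∂P = 0 := by
  rw [← integral_condExp hm]
  refine integral_eq_zero_of_ae ?_
  filter_upwards [condExp_bilin_of_stronglyMeasurable_left B hf hfg hg, hg0] with ω pull_out zero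
  rw [pull_out, zero, Pi.zero_apply, Pi.zero_apply, map_zero]

lemma condExp_clm_comp_eq_zero {E F : Type*} [NormedAddCommGroup E] [NormedSpace ℝ E]
    [CompleteSpace E] [NormedAddCommGroup F] [NormedSpace ℝ F] [CompleteSpace F] {g : Ω → E}
    (hg : Integrable g P) (hg0 : P[g | m] =ᵐ[P] 0) (T : E →L[ℝ] F) :
    P[fun ω => T (g ω) | m] =ᵐ[P] 0 := by
  refine (T.comp_condExp_comm hg (m := m)).symm.trans ?_
  filter_upwards [hg0] with ω zero
  rw [Function.comp_apply, zero, Pi.zero_apply, Pi.zero_apply, map_zero]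

/-- The fourth absolute moment `E ‖X‖⁴` of a random vector, equal to `0` when `‖X‖⁴` is not
integrable. -/
noncomputable def fourthMoment {E : Type*} [Norm E] (P : Measure Ω) (X : Ω → E) : ℝ :=
  ∫ ω, ‖X ω‖ ^ 4 ∂P

lemma fourthMoment_nonneg {E : Type*} [Norm E] (P : Measure Ω) (X : Ω → E) :
    0 ≤ fourthMoment P X :=
  integral_nonneg fun ω => Even.pow_nonneg (by decide) ‖X ω‖

lemma fourthMoment_le_mul {E F : Type*} [NormedAddCommGroup E] [NormedAddCommGroup F]
    {X : Ω → E} {Y : Ω → F} {c : ℝ} (hY : MemLp Y 4 P) (hXY : ∀ ω, ‖X ω‖ ≤ c * ‖Y ω‖) :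
    fourthMoment P X ≤ c ^ 4 * fourthMoment P Y := by
  rw [fourthMoment, fourthMoment, ← integral_const_mul]
  refine integral_mono_of_nonneg (ae_of_all _ fun ω => by positivity)
    (((memLp_four_iff_integrable hY.1).1 hY).const_mul _) (ae_of_all _ fun ω => ?_)
  simpa only [mul_pow] using pow_le_pow_left₀ (norm_nonneg _) (hXY ω) 4

lemma fourthMoment_sum_smul_le {E ι : Type*} [NormedAddCommGroup E] [NormedSpace ℝ E] [Fintype ι]
    {a : ι → ℝ} (ha : ∀ i, 0 ≤ a i) (ha1 : ∑ i, a i = 1) {Y : ι → Ω → E}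
    (hY : ∀ i, MemLp (Y i) 4 P) :
    fourthMoment P (fun ω => ∑ i, a i • Y i ω) ≤ ∑ i, a i * fourthMoment P (Y i) := by
  have integrable (i : ι) : Integrable (fun ω => a i * ‖Y i ω‖ ^ 4) P :=
    ((memLp_four_iff_integrable (hY i).1).1 (hY i)).const_mul _
  simp only [fourthMoment, ← integral_const_mul]
  rw [← integral_finsetSum _ fun i _ => integrable i]
  exact integral_mono_of_nonneg (ae_of_all _ fun ω => by positivity)
    (integrable_finsetSum _ fun i _ => integrable i)
    (ae_of_all _ fun ω => norm_sum_smul_pow_le ha ha1 (fun i => Y i ω) 4)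

lemma fourthMoment_le_sum {ι : Type*} [Fintype ι] {β : ι → Type*}
    [∀ i, NormedAddCommGroup (β i)] {X : Ω → PiLp 2 β} (hX : MemLp X 4 P)
    {q : ι → ℝ} (hq : ∀ i, 0 < q i) :
    fourthMoment P X ≤ (∑ i, (q i)⁻¹) * ∑ i, q i * fourthMoment P fun ω => X ω i := by
  have integrable (i : ι) : Integrable (fun ω => q i * ‖X ω i‖ ^ 4) P :=
    ((memLp_four_iff_integrable (hX.eval_piLp i).1).1 (hX.eval_piLp i)).const_mul _
  simp only [fourthMoment, ← integral_const_mul]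
  rw [← integral_finsetSum _ fun i _ => integrable i, ← integral_const_mul]
  exact integral_mono_of_nonneg (ae_of_all _ fun ω => by positivity)
    ((integrable_finsetSum _ fun i _ => integrable i).const_mul _)
    (ae_of_all _ fun ω => norm_pow_four_le_sum (X ω) hq)

lemma fourthMoment_sub_le [IsFiniteMeasure P] (hm : m ≤ mΩ) {E : Type*} [NormedAddCommGroup E]
    [InnerProductSpace ℝ E] [CompleteSpace E] {X S : Ω → E} (hX : StronglyMeasurable[m] X)
    (hX4 : MemLp X 4 P) (hS4 : MemLp S 4 P) (hS0 : P[S | m] =ᵐ[P] 0) {η : ℝ} (hη : 0 < η) :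
    fourthMoment P (fun ω => X ω - S ω)
      ≤ (1 + η) * fourthMoment P X + (16 / η + 3) * fourthMoment P S := by
  have integrable_X := (memLp_four_iff_integrable hX4.1).1 hX4
  have integrable_S := (memLp_four_iff_integrable hS4.1).1 hS4
  have measurable_cube : StronglyMeasurable[m] fun ω => ‖X ω‖ ^ 2 • X ω := (hX.norm.pow 2).smul hX
  have integrable_cross : Integrable (fun ω => inner ℝ (‖X ω‖ ^ 2 • X ω) (S ω)) P :=
    (integrable_X.add integrable_S).mono'
      ((measurable_cube.mono hm).aestronglyMeasurable.inner hS4.1)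
      (ae_of_all _ fun ω => abs_inner_norm_sq_smul_le (X ω) (S ω))
  have cross_eq_zero : ∫ ω, inner ℝ (‖X ω‖ ^ 2 • X ω) (S ω) ∂P = 0 :=
    integral_bilin_eq_zero_of_condExp_eq_zero hm (innerSL ℝ) measurable_cube integrable_cross
      (hS4.integrable (by norm_num)) hS0
  have integrable_difference : Integrable (fun ω =>
      (1 + η) * ‖X ω‖ ^ 4 - 4 * inner ℝ (‖X ω‖ ^ 2 • X ω) (S ω)) P :=
    (integrable_X.const_mul _).sub (integrable_cross.const_mul _)
  calc fourthMoment P (fun ω => X ω - S ω)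
      ≤ ∫ ω, ((1 + η) * ‖X ω‖ ^ 4 - 4 * inner ℝ (‖X ω‖ ^ 2 • X ω) (S ω)
        + (16 / η + 3) * ‖S ω‖ ^ 4) ∂P :=
      integral_mono_of_nonneg (ae_of_all _ fun ω => by positivity)
        (integrable_difference.add (integrable_S.const_mul _))
        (ae_of_all _ fun ω => norm_sub_pow_four_le (X ω) (S ω) hη)
    _ = (1 + η) * fourthMoment P X + (16 / η + 3) * fourthMoment P S := by
      rw [integral_add integrable_difference (integrable_S.const_mul _),
        integral_sub (integrable_X.const_mul _) (integrable_cross.const_mul _),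
        integral_const_mul, integral_const_mul, integral_const_mul, cross_eq_zero, mul_zero,
        sub_zero, fourthMoment, fourthMoment]

end FourthMoment

section PiLp

variable {Ω ι : Type*} {m mΩ : MeasurableSpace Ω} {β : ι → Type*} [∀ i, NormedAddCommGroup (β i)]

lemma stronglyMeasurable_piLp_apply {f : Ω → PiLp 2 β} (hf : StronglyMeasurable[m] f) (i : ι) :
    StronglyMeasurable[m] fun ω => f ω i :=
  (PiLp.continuous_apply 2 β i).comp_stronglyMeasurable hf

lemma stronglyMeasurable_of_piLp_apply [Finite ι] {f : Ω → PiLp 2 β}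
    (hf : ∀ i, StronglyMeasurable[m] fun ω => f ω i) : StronglyMeasurable[m] f := by
  classical
  have := Fintype.ofFinite ι
  have sum_single (ω : Ω) : f ω = ∑ i, WithLp.toLp 2 (Pi.single i (f ω i)) := by
    ext i
    simp [Finset.sum_pi_single]
  rw [funext sum_single]
  exact Finset.stronglyMeasurable_fun_sum _ fun i _ =>
    ((PiLp.continuous_toLp 2 β).comp (continuous_single i)).comp_stronglyMeasurable (hf i)

end PiLp

section SecondMoment

variable {Ω : Type*} {mΩ : MeasurableSpace Ω} {P : Measure Ω} {l m n : Type*}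

/-- The matrix of mixed second moments `E[X Yᵀ]`, with `secondMoment P X = crossMoment P X X`. -/
noncomputable def crossMoment (P : Measure Ω) (X : Ω → EuclideanSpace ℝ m)
    (Y : Ω → EuclideanSpace ℝ n) : Matrix m n ℝ :=
  Matrix.of fun i j => ∫ ω, X ω i * Y ω j ∂P

lemma transpose_crossMoment (X : Ω → EuclideanSpace ℝ m) (Y : Ω → EuclideanSpace ℝ n) :
    (crossMoment P X Y)ᵀ = crossMoment P Y X := by
  ext i j
  simp only [crossMoment, Matrix.transpose_apply, Matrix.of_apply, mul_comm]

variable [Fintype m] [Fintype n]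

lemma integrable_apply_mul_apply {X : Ω → EuclideanSpace ℝ m} {Y : Ω → EuclideanSpace ℝ n}
    (hX : MemLp X 2 P) (hY : MemLp Y 2 P) (i : m) (j : n) :
    Integrable (fun ω => X ω i * Y ω j) P :=
  (hX.eval_piLp i).integrable_mul (hY.eval_piLp j)

lemma crossMoment_add_left {X X' : Ω → EuclideanSpace ℝ m} {Y : Ω → EuclideanSpace ℝ n}
    (hX : MemLp X 2 P) (hX' : MemLp X' 2 P) (hY : MemLp Y 2 P) :
    crossMoment P (X + X') Y = crossMoment P X Y + crossMoment P X' Y := by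
  ext i j
  simp only [crossMoment, Matrix.of_apply, Matrix.add_apply, Pi.add_apply, PiLp.add_apply, add_mul]
  exact integral_add (integrable_apply_mul_apply hX hY i j) (integrable_apply_mul_apply hX' hY i j)

lemma crossMoment_add_right {X : Ω → EuclideanSpace ℝ m} {Y Y' : Ω → EuclideanSpace ℝ n}
    (hX : MemLp X 2 P) (hY : MemLp Y 2 P) (hY' : MemLp Y' 2 P) :
    crossMoment P X (Y + Y') = crossMoment P X Y + crossMoment P X Y' := by
  rw [← transpose_crossMoment, crossMoment_add_left hY hY' hX, Matrix.transpose_add,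
    transpose_crossMoment, transpose_crossMoment]

lemma crossMoment_mulVec_left {X : Ω → EuclideanSpace ℝ m}
    {Y : Ω → EuclideanSpace ℝ n} (hX : MemLp X 2 P) (hY : MemLp Y 2 P) (D : Matrix l m ℝ) :
    crossMoment P (fun ω => WithLp.toLp 2 (D *ᵥ X ω)) Y = D * crossMoment P X Y := by
  ext i j
  simp only [crossMoment, Matrix.of_apply, Matrix.mul_apply, Matrix.mulVec, dotProduct,
    Finset.sum_mul, mul_assoc]
  rw [integral_finsetSum _ fun k _ => (integrable_apply_mul_apply hX hY k j).const_mul _]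
  simp only [integral_const_mul]

lemma crossMoment_mulVec_right {X : Ω → EuclideanSpace ℝ m}
    {Y : Ω → EuclideanSpace ℝ n} (hX : MemLp X 2 P) (hY : MemLp Y 2 P) (B : Matrix l n ℝ) :
    crossMoment P X (fun ω => WithLp.toLp 2 (B *ᵥ Y ω)) = crossMoment P X Y * Bᵀ := by
  rw [← transpose_crossMoment, crossMoment_mulVec_left hY hX, Matrix.transpose_mul,
    transpose_crossMoment]

lemma memLp_mulVec [Fintype l] {q : ENNReal} {X : Ω → EuclideanSpace ℝ m} (hX : MemLp X q P)
    (D : Matrix l m ℝ) : MemLp (fun ω => (WithLp.toLp 2 (D *ᵥ X ω) : EuclideanSpace ℝ l)) q P := by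
  classical
  exact (Matrix.toEuclideanLin D).toContinuousLinearMap.comp_memLp' hX

lemma stronglyMeasurable_mulVec [Finite l] {X : Ω → EuclideanSpace ℝ m}
    (hX : StronglyMeasurable X) (D : Matrix l m ℝ) :
    StronglyMeasurable fun ω => (WithLp.toLp 2 (D *ᵥ X ω) : EuclideanSpace ℝ l) := by
  classical
  have := Fintype.ofFinite l
  exact (Matrix.toEuclideanLin D).toContinuousLinearMap.continuous.comp_stronglyMeasurable hX

lemma secondMoment_mulVec_add_mulVec [Fintype l] {X : Ω → EuclideanSpace ℝ m}
    {Y : Ω → EuclideanSpace ℝ n} (hX : MemLp X 2 P) (hY : MemLp Y 2 P)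
    (uncorrelated : crossMoment P X Y = 0) (D : Matrix l m ℝ) (B : Matrix l n ℝ) :
    secondMoment P (fun ω => WithLp.toLp 2 (D *ᵥ X ω + B *ᵥ Y ω))
      = D * secondMoment P X * Dᵀ + B * secondMoment P Y * Bᵀ := by
  have hDX := memLp_mulVec hX D
  have hBY := memLp_mulVec hY B
  change crossMoment P ((fun ω => WithLp.toLp 2 (D *ᵥ X ω)) + fun ω => WithLp.toLp 2 (B *ᵥ Y ω))
      ((fun ω => WithLp.toLp 2 (D *ᵥ X ω)) + fun ω => WithLp.toLp 2 (B *ᵥ Y ω))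
    = D * crossMoment P X X * Dᵀ + B * crossMoment P Y Y * Bᵀ
  have uncorrelated' : crossMoment P Y X = 0 := by
    rw [← transpose_crossMoment, uncorrelated, Matrix.transpose_zero]
  rw [crossMoment_add_left hDX hBY (hDX.add hBY), crossMoment_add_right hDX hDX hBY,
    crossMoment_add_right hBY hDX hBY]
  simp only [crossMoment_mulVec_left, crossMoment_mulVec_right, hX, hY, hDX, hBY, uncorrelated,
    uncorrelated', Matrix.zero_mul, Matrix.mul_zero, add_zero, zero_add, Matrix.mul_assoc]

end SecondMoment

section MatrixIntegral

variable {Ω : Type*} {mΩ : MeasurableSpace Ω} {P : Measure Ω} {m n : Type*} [Fintype m] [Fintype n]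
  [DecidableEq n]

lemma integrable_matrix {B : Ω → Matrix m n ℝ} (hB : ∀ i j, Integrable (fun ω => B ω i j) P) :
    Integrable B P :=
  (Matrix.ofLinearEquiv ℝ : (m → n → ℝ) ≃ₗ[ℝ] Matrix m n ℝ).toContinuousLinearEquiv
    |>.integrable_comp_iff.2 (.of_eval fun i => .of_eval fun j => hB i j)

lemma integral_matrix {B : Ω → Matrix m n ℝ} (hB : ∀ i j, Integrable (fun ω => B ω i j) P) :
    ∫ ω, B ω ∂P = Matrix.of fun i j => ∫ ω, B ω i j ∂P := by
  ext i j
  exact (((Matrix.entryLinearMap ℝ ℝ i j).toContinuousLinearMap).integral_comp_comm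
    (integrable_matrix hB)).symm

end MatrixIntegral

lemma rpow_le_mul_one_add_pow_four {r t γ : ℝ} (hr : 0 ≤ r) (ht : 0 < t) (hγ : 0 ≤ γ)
    (hγ4 : γ ≤ 4) : r ^ γ ≤ t ^ (γ / 2) * (1 + r ^ 4 / t ^ 2) := by
  set u := r ^ 2 / t
  have hu : 0 ≤ u := by positivity
  have rpow_eq : r ^ γ = t ^ (γ / 2) * u ^ (γ / 2) := by
    rw [← Real.mul_rpow ht.le hu, mul_div_cancel₀ _ ht.ne', ← Real.rpow_natCast,
      ← Real.rpow_mul hr]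
    congr 1
    push_cast
    ring
  rw [rpow_eq, show r ^ 4 / t ^ 2 = u ^ 2 by ring]
  gcongr
  rcases le_total u 1 with hu1 | hu1
  · linarith [Real.rpow_le_one hu hu1 (by positivity : 0 ≤ γ / 2), sq_nonneg u]
  · have rpow_le_sq := Real.rpow_le_rpow_of_exponent_le hu1 (by linarith : γ / 2 ≤ 2)
    rw [Real.rpow_two] at rpow_le_sq
    linarith

/-- The conditions on the costs that make the diffusion recursion contract: `w_k^o` minimizes `J_k`
and is common to a group, and `J_k` is twice differentiable with Hessian between `lamL k` and
`lamU k`, where `lamL` is positive somewhere in each group. -/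
structure HasHessianBounds {N G M : ℕ} (net : Network N G) (J : Fin N → Vec M → ℝ)
    (wo : Fin N → Vec M) (lamL lamU : Fin N → ℝ) : Prop where
  minimizer : ∀ k, IsMinOn (J k) Set.univ (wo k)
  same_cluster : ∀ k l, net.group k = net.group l → wo k = wo l
  differentiable : ∀ k, Differentiable ℝ (J k)
  differentiable_gradient : ∀ k, Differentiable ℝ (gradient (J k))
  lamL_nonneg : ∀ k, 0 ≤ lamL k
  lamL_le_lamU : ∀ k, lamL k ≤ lamU k
  lower : ∀ k w, (hess (J k) w - lamL k • (1 : Matrix (Fin M) (Fin M) ℝ)).PosSemidef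
  upper : ∀ k w, (lamU k • (1 : Matrix (Fin M) (Fin M) ℝ) - hess (J k) w).PosSemidef
  exists_lamL_pos : ∀ m : Fin G, ∃ k, net.group k = m ∧ 0 < lamL k

lemma CostAssumption.exists_hasHessianBounds {N G M : ℕ} {net : Network N G}
    {J : Fin N → Vec M → ℝ} {wo : Fin N → Vec M} (hJ : CostAssumption net J wo) :
    ∃ lamL lamU, HasHessianBounds net J wo lamL lamU := by
  obtain ⟨lamL, lamU, nonneg, lower, upper, exists_pos⟩ := hJ.hess_bounds
  exact ⟨lamL, lamU, hJ.minimizer, hJ.same_cluster, hJ.differentiable,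
    hJ.twice_differentiable, fun k => (nonneg k).1, fun k => (nonneg k).2, lower, upper,
    exists_pos⟩

section Diffusion

variable {N G M : ℕ} {Ω : Type*} {mΩ : MeasurableSpace Ω} {P : Measure Ω}
  {ℱ : Filtration ℕ mΩ} {net : Network N G} {A : Matrix (Fin N) (Fin N) ℝ}
  {J : Fin N → Vec M → ℝ} {wo : Fin N → Vec M} {lamL lamU : Fin N → ℝ}
  {gradHat : Fin N → ℕ → Ω → Vec M → Vec M} {γ : ℝ}
  {Rs : Matrix (Fin N × Fin M) (Fin N × Fin M) ℝ} {p μ : Fin N → ℝ} {W₀ : Ω → NetVec N M}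
  {X₀ : Ω → EuclideanSpace ℝ (Fin G × Fin M)}

/-- The deviation from the minimizer of agent `k` after an exact gradient step from `w`. -/
noncomputable def gradStepError (J : Fin N → Vec M → ℝ) (wo : Fin N → Vec M) (μ : Fin N → ℝ)
    (k : Fin N) (w : Vec M) : Vec M :=
  w - μ k • gradient (J k) w - wo k

lemma HasHessianBounds.lamU_nonneg (hJ : HasHessianBounds net J wo lamL lamU) (k : Fin N) :
    0 ≤ lamU k :=
  (hJ.lamL_nonneg k).trans (hJ.lamL_le_lamU k)

lemma HasHessianBounds.continuous_gradStepError (hJ : HasHessianBounds net J wo lamL lamU)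
    (k : Fin N) : Continuous (gradStepError J wo μ k) := by
  have := (hJ.differentiable_gradient k).continuous
  unfold gradStepError
  fun_prop

lemma HasHessianBounds.norm_gradStepError_le (hJ : HasHessianBounds net J wo lamL lamU)
    {k : Fin N} (hμ : 0 ≤ μ k) (hμU : μ k * lamU k ≤ 1) (w : Vec M) :
    ‖gradStepError J wo μ k w‖ ≤ (1 - μ k * lamL k) * ‖w - wo k‖ := by
  have contraction := norm_gradient_step_sub_le (hJ.differentiable_gradient k) (hJ.lower k)
    (hJ.upper k) (hJ.lamL_le_lamU k) hμ hμU w (wo k)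
  rwa [gradient_eq_zero_of_isMinOn (hJ.minimizer k), smul_zero, sub_zero] at contraction

lemma NoiseAssumption.memLp_noise (hs : NoiseAssumption P ℱ J wo gradHat γ Rs) {n : ℕ}
    {W : Ω → NetVec N M} (hW : StronglyMeasurable[ℱ n] W) (hW4 : MemLp W 4 P) :
    MemLp (noise J gradHat (n + 1) W) 4 P := by
  obtain ⟨_, _, -, -, bound⟩ := hs.fourth_moment
  exact (memLp_four_iff_integrable
    ((hs.adapted n W hW hW4).mono (ℱ.le _)).aestronglyMeasurable).2 (bound n W hW hW4).1

lemma NoiseAssumption.exists_fourthMoment_noise_le [IsProbabilityMeasure P]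
    (hs : NoiseAssumption P ℱ J wo gradHat γ Rs) :
    ∃ a ≥ 0, ∃ b, ∀ (n : ℕ) (W : Ω → NetVec N M), StronglyMeasurable[ℱ n] W → MemLp W 4 P →
      fourthMoment P (noise J gradHat (n + 1) W)
        ≤ a * fourthMoment P (fun ω => W ω - netMin wo) + b := by
  obtain ⟨α, σ, -, -, bound⟩ := hs.fourth_moment
  refine ⟨α ^ 2, by positivity, σ ^ 4, fun n W hW hW4 => ?_⟩
  have memLp_error : MemLp (fun ω => W ω - netMin wo) 4 P := hW4.sub (memLp_const _)
  have integrable_error := (memLp_four_iff_integrable memLp_error.1).1 memLp_error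
  rw [fourthMoment, fourthMoment, ← integral_condExp (ℱ.le n), ← integral_const_mul]
  calc ∫ ω, (P[fun ω' => ‖noise J gradHat (n + 1) W ω'‖ ^ 4 | ℱ n]) ω ∂P
      ≤ ∫ ω, (α ^ 2 * ‖W ω - netMin wo‖ ^ 4 + σ ^ 4) ∂P := by
        refine integral_mono_ae integrable_condExp
          ((integrable_error.const_mul _).add (integrable_const _)) ?_
        filter_upwards [(bound n W hW hW4).2] with ω conditional_bound
        rwa [norm_sub_rev (netMin wo)] at conditional_bound
    _ = ∫ ω, α ^ 2 * ‖W ω - netMin wo‖ ^ 4 ∂P + σ ^ 4 := by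
        rw [integral_add (integrable_error.const_mul _) (integrable_const _)]
        simp

lemma iterates_succ_sub (hA : IsCombination net A)
    (hwo : ∀ k l, net.group k = net.group l → wo k = wo l) (n : ℕ) (ω : Ω) (k : Fin N) :
    iterates net A gradHat μ W₀ (n + 1) ω k - wo k
      = ∑ l, A l k • (gradStepError J wo μ l (iterates net A gradHat μ W₀ n ω l)
        - μ l • noise J gradHat (n + 1) (iterates net A gradHat μ W₀ n) ω l) := by
  have wo_eq : wo k = ∑ l ∈ net.groupNbhd k, A l k • wo l := by
    rw [Finset.sum_congr rfl fun l hl => by rw [hwo l k (Network.mem_groupNbhd.1 hl).2],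
      hA.sum_groupNbhd, ← Finset.sum_smul, hA.sum_one, one_smul]
  rw [← hA.sum_groupNbhd]
  conv_lhs => rw [wo_eq]
  simp only [iterates]
  rw [← Finset.sum_sub_distrib]
  refine Finset.sum_congr rfl fun l _ => ?_
  simp only [noise, gradStepError]
  module

lemma memLp_gradStepError [IsFiniteMeasure P] (hJ : HasHessianBounds net J wo lamL lamU)
    {k : Fin N} (hμ : 0 ≤ μ k) (hμU : μ k * lamU k ≤ 1) {W : Ω → NetVec N M}
    (hW4 : MemLp W 4 P) : MemLp (fun ω => gradStepError J wo μ k (W ω k)) 4 P := by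
  have memLp_error : MemLp (fun ω => W ω k - wo k) 4 P := (hW4.eval_piLp k).sub (memLp_const _)
  refine memLp_error.of_le_mul (c := 1 - μ k * lamL k)
    ((hJ.continuous_gradStepError k).comp_aestronglyMeasurable (hW4.eval_piLp k).1)
    (ae_of_all _ fun ω => hJ.norm_gradStepError_le hμ hμU _)

lemma iterates_regular [IsFiniteMeasure P] (hA : IsCombination net A)
    (hJ : HasHessianBounds net J wo lamL lamU) (hs : NoiseAssumption P ℱ J wo gradHat γ Rs)
    (hμ : ∀ k, 0 ≤ μ k) (hμU : ∀ k, μ k * lamU k ≤ 1)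
    (hW₀ : StronglyMeasurable[ℱ 0] W₀) (hW₀4 : MemLp W₀ 4 P) (n : ℕ) :
    StronglyMeasurable[ℱ n] (iterates net A gradHat μ W₀ n) ∧
      MemLp (iterates net A gradHat μ W₀ n) 4 P := by
  induction n with
  | zero => exact ⟨hW₀, hW₀4⟩
  | succ n ih =>
    obtain ⟨measurable, memLp⟩ := ih
    have component_eq (k : Fin N) : (fun ω => iterates net A gradHat μ W₀ (n + 1) ω k)
        = fun ω => (∑ l, A l k • (gradStepError J wo μ l (iterates net A gradHat μ W₀ n ω l)
          - μ l • noise J gradHat (n + 1) (iterates net A gradHat μ W₀ n) ω l)) + wo k :=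
      funext fun ω => sub_eq_iff_eq_add.1 (iterates_succ_sub hA hJ.same_cluster n ω k)
    constructor
    · refine stronglyMeasurable_of_piLp_apply fun k => ?_
      rw [component_eq k]
      refine (Finset.stronglyMeasurable_fun_sum _ fun l _ => ?_).add stronglyMeasurable_const
      exact ((((hJ.continuous_gradStepError l).comp_stronglyMeasurable
        (stronglyMeasurable_piLp_apply measurable l)).mono (ℱ.mono n.le_succ)).sub
        ((stronglyMeasurable_piLp_apply (hs.adapted n _ measurable memLp) l).const_smul
          (μ l))).const_smul (A l k)
    · refine MemLp.of_eval_piLp fun k => ?_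
      rw [component_eq k]
      refine (memLp_finsetSum _ fun l _ => ?_).add (memLp_const _)
      exact ((memLp_gradStepError hJ (hμ l) (hμU l) memLp).sub
        (((hs.memLp_noise measurable memLp).eval_piLp l).const_smul (μ l))).const_smul (A l k)

/-- The sum of the fourth moments of the individual errors `W_k - w_k^o`, weighted by `q`. For
suitable `q` close to the Perron vector it is a Lyapunov function of the diffusion recursion. -/
noncomputable def weightedMoment (P : Measure Ω) (wo : Fin N → Vec M) (q : Fin N → ℝ)
    (W : Ω → NetVec N M) : ℝ :=
  ∑ k, q k * fourthMoment P fun ω => W ω k - wo k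

lemma fourthMoment_noisy_step_le [IsProbabilityMeasure P]
    (hJ : HasHessianBounds net J wo lamL lamU) (hs : NoiseAssumption P ℱ J wo gradHat γ Rs)
    {k : Fin N} (hμ : 0 ≤ μ k) (hμU : μ k * lamU k ≤ 1) {η : ℝ} (hη : 0 < η) {n : ℕ}
    {W : Ω → NetVec N M} (hW : StronglyMeasurable[ℱ n] W) (hW4 : MemLp W 4 P) :
    fourthMoment P (fun ω => gradStepError J wo μ k (W ω k) - μ k • noise J gradHat (n + 1) W ω k)
      ≤ (1 + η) * ((1 - μ k * lamL k) * fourthMoment P fun ω => W ω k - wo k)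
        + (16 / η + 3) * (μ k ^ 4 * fourthMoment P (noise J gradHat (n + 1) W)) := by
  have memLp_noise := hs.memLp_noise hW hW4
  have memLp_error : MemLp (fun ω => W ω k - wo k) 4 P := (hW4.eval_piLp k).sub (memLp_const _)
  have noise_centered : P[fun ω => μ k • noise J gradHat (n + 1) W ω k | ℱ n] =ᵐ[P] 0 :=
    condExp_clm_comp_eq_zero (memLp_noise.integrable (by norm_num)) (hs.martingale_diff n W hW hW4)
      (μ k • PiLp.proj (𝕜 := ℝ) 2 (fun _ : Fin N => Vec M) k)
  refine (fourthMoment_sub_le (ℱ.le n)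
    ((hJ.continuous_gradStepError k).comp_stronglyMeasurable (stronglyMeasurable_piLp_apply hW k))
    (memLp_gradStepError hJ hμ hμU hW4) ((memLp_noise.eval_piLp k).const_smul (μ k))
    noise_centered hη).trans ?_
  have factor_nonneg : 0 ≤ 1 - μ k * lamL k :=
    sub_nonneg.2 ((mul_le_mul_of_nonneg_left (hJ.lamL_le_lamU k) hμ).trans hμU)
  have factor_le_one : 1 - μ k * lamL k ≤ 1 :=
    sub_le_self _ (mul_nonneg hμ (hJ.lamL_nonneg k))
  gcongr
  · refine (fourthMoment_le_mul memLp_error fun ω => hJ.norm_gradStepError_le hμ hμU _).trans ?_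
    exact mul_le_mul_of_nonneg_right
      (pow_le_of_le_one factor_nonneg factor_le_one (by norm_num)) (fourthMoment_nonneg _ _)
  · refine fourthMoment_le_mul memLp_noise fun ω => ?_
    rw [Pi.smul_apply, norm_smul, Real.norm_of_nonneg hμ]
    exact mul_le_mul_of_nonneg_left (PiLp.norm_apply_le _ k) hμ

lemma weightedMoment_iterates_succ_le_sum [IsFiniteMeasure P] (hA : IsCombination net A)
    (hJ : HasHessianBounds net J wo lamL lamU) (hs : NoiseAssumption P ℱ J wo gradHat γ Rs)
    (hμ : ∀ k, 0 ≤ μ k) (hμU : ∀ k, μ k * lamU k ≤ 1) {q : Fin N → ℝ} (hq : ∀ k, 0 ≤ q k) {n : ℕ}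
    (hm : StronglyMeasurable[ℱ n] (iterates net A gradHat μ W₀ n))
    (h4 : MemLp (iterates net A gradHat μ W₀ n) 4 P) :
    weightedMoment P wo q (iterates net A gradHat μ W₀ (n + 1))
      ≤ ∑ l, (A *ᵥ q) l * fourthMoment P fun ω =>
        gradStepError J wo μ l (iterates net A gradHat μ W₀ n ω l)
          - μ l • noise J gradHat (n + 1) (iterates net A gradHat μ W₀ n) ω l := by
  set Y : Fin N → Ω → Vec M := fun l ω =>
    gradStepError J wo μ l (iterates net A gradHat μ W₀ n ω l)
      - μ l • noise J gradHat (n + 1) (iterates net A gradHat μ W₀ n) ω l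
  have memLp_step (l : Fin N) : MemLp (Y l) 4 P := (memLp_gradStepError hJ (hμ l) (hμU l) h4).sub
    (((hs.memLp_noise hm h4).eval_piLp l).const_smul (μ l))
  calc weightedMoment P wo q (iterates net A gradHat μ W₀ (n + 1))
      = ∑ k, q k * fourthMoment P fun ω => ∑ l, A l k • Y l ω := by
        simp only [weightedMoment, iterates_succ_sub (J := J) hA hJ.same_cluster, Y]
    _ ≤ ∑ k, q k * ∑ l, A l k * fourthMoment P (Y l) := by
        gcongr with k
        · exact hq k
        · exact fourthMoment_sum_smul_le (hA.nonneg · k) (hA.sum_one k) memLp_step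
    _ = ∑ l, (A *ᵥ q) l * fourthMoment P (Y l) := by
        simp only [Matrix.mulVec, dotProduct, Finset.mul_sum, Finset.sum_mul]
        rw [Finset.sum_comm]
        exact Finset.sum_congr rfl fun l _ => Finset.sum_congr rfl fun k _ => by ring

lemma weightedMoment_iterates_succ_le [IsProbabilityMeasure P] (hA : IsCombination net A)
    (hJ : HasHessianBounds net J wo lamL lamU) (hs : NoiseAssumption P ℱ J wo gradHat γ Rs)
    {t : ℝ} (hμ : ∀ k, 0 ≤ μ k) (hμt : ∀ k, μ k ≤ t) (hμU : ∀ k, μ k * lamU k ≤ 1)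
    {q : Fin N → ℝ} (hq : ∀ k, 0 ≤ q k) {ρ : ℝ} (hρ : 0 < ρ)
    (contracting : ∀ l, (A *ᵥ q) l * (1 - μ l * lamL l) ≤ (1 - ρ) * q l) {n : ℕ}
    (hm : StronglyMeasurable[ℱ n] (iterates net A gradHat μ W₀ n))
    (h4 : MemLp (iterates net A gradHat μ W₀ n) 4 P) :
    weightedMoment P wo q (iterates net A gradHat μ W₀ (n + 1))
      ≤ (1 - ρ / 2) * weightedMoment P wo q (iterates net A gradHat μ W₀ n)
        + (16 / (ρ / 2) + 3) * t ^ 4 * (∑ k, q k)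
          * fourthMoment P (noise J gradHat (n + 1) (iterates net A gradHat μ W₀ n)) := by
  set W := iterates net A gradHat μ W₀ n
  set S := fourthMoment P (noise J gradHat (n + 1) W)
  set e : Fin N → ℝ := fun l => fourthMoment P fun ω => W ω l - wo l
  have summand_le (l : Fin N) : (A *ᵥ q) l * (fourthMoment P fun ω =>
      gradStepError J wo μ l (W ω l) - μ l • noise J gradHat (n + 1) W ω l)
      ≤ (1 - ρ / 2) * (q l * e l) + (A *ᵥ q) l * ((16 / (ρ / 2) + 3) * t ^ 4 * S) := by
    have step := fourthMoment_noisy_step_le hJ hs (hμ l) (hμU l) (half_pos hρ) hm h4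
    have noise_le : (16 / (ρ / 2) + 3) * (μ l ^ 4 * S) ≤ (16 / (ρ / 2) + 3) * t ^ 4 * S := by
      rw [mul_assoc]
      gcongr
      exacts [fourthMoment_nonneg _ _, hμ l, hμt l]
    have weight_nonneg := hA.mulVec_nonneg hq l
    have e_nonneg : 0 ≤ e l := fourthMoment_nonneg _ _
    have contracted : (1 + ρ / 2) * ((A *ᵥ q) l * (1 - μ l * lamL l) * e l)
        ≤ (1 - ρ / 2) * (q l * e l) := by
      calc (1 + ρ / 2) * ((A *ᵥ q) l * (1 - μ l * lamL l) * e l)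
          ≤ (1 + ρ / 2) * ((1 - ρ) * q l * e l) :=
          mul_le_mul_of_nonneg_left (mul_le_mul_of_nonneg_right (contracting l) e_nonneg)
            (by positivity)
        _ = (1 - ρ / 2) * (q l * e l) - ρ ^ 2 / 2 * (q l * e l) := by ring
        _ ≤ (1 - ρ / 2) * (q l * e l) :=
          sub_le_self _ (mul_nonneg (by positivity) (mul_nonneg (hq l) e_nonneg))
    linear_combination (A *ᵥ q) l * step + (A *ᵥ q) l * noise_le + contracted
  refine (weightedMoment_iterates_succ_le_sum hA hJ hs hμ hμU hq hm h4).trans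
    ((Finset.sum_le_sum fun l _ => summand_le l).trans_eq ?_)
  rw [Finset.sum_add_distrib, ← Finset.mul_sum, ← Finset.sum_mul, hA.sum_mulVec, weightedMoment]
  ring

lemma exists_contracting_weights (hA : IsCombination net A) (hp : IsPerron net A p)
    {lam : Fin N → ℝ} (hlam : ∀ k, 0 ≤ lam k)
    (hgroup : ∀ m : Fin G, ∃ k, net.group k = m ∧ 0 < lam k) :
    ∃ δ > 0, ∃ Q H : ℝ, ∀ᶠ t in 𝓝[>] (0 : ℝ), ∃ q : Fin N → ℝ, (∀ k, 0 < q k) ∧ ∑ k, q k ≤ Q ∧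
      ∑ k, (q k)⁻¹ ≤ H ∧ ∀ l, (A *ᵥ q) l * (1 - t * lam l) ≤ (1 - δ * t) * q l := by
  obtain ⟨δ, hδ, r, contracting⟩ := hp.exists_contracting_direction hA hlam hgroup
  have weight_tendsto (k : Fin N) : Tendsto (fun t : ℝ => (p + t • r) k) (𝓝[>] 0) (𝓝 (p k)) := by
    have continuous : Continuous fun t : ℝ => (p + t • r) k := by fun_prop
    simpa using (continuous.tendsto 0).mono_left nhdsWithin_le_nhds
  have sum_lt := (tendsto_finsetSum Finset.univ fun k _ => weight_tendsto k).eventually_lt_const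
    (lt_add_one _)
  have sum_inv_lt := (tendsto_finsetSum Finset.univ fun k _ =>
    (weight_tendsto k).inv₀ (hp.pos hA k).ne').eventually_lt_const (lt_add_one _)
  refine ⟨δ, hδ, ∑ k, p k + 1, ∑ k, (p k)⁻¹ + 1, ?_⟩
  filter_upwards [contracting, sum_lt, sum_inv_lt,
    eventually_all.2 fun k => (weight_tendsto k).eventually_const_lt (hp.pos hA k)]
    with t contracting sum_lt sum_inv_lt pos
  exact ⟨p + t • r, pos, sum_lt.le, sum_inv_lt.le, contracting⟩

lemma weightedMoment_nonneg {q : Fin N → ℝ} (hq : ∀ k, 0 < q k) (W : Ω → NetVec N M) :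
    0 ≤ weightedMoment P wo q W :=
  Finset.sum_nonneg fun k _ => mul_nonneg (hq k).le (fourthMoment_nonneg _ _)

lemma fourthMoment_sub_netMin_le [IsFiniteMeasure P] {q : Fin N → ℝ} (hq : ∀ k, 0 < q k) {H : ℝ}
    (hH : ∑ k, (q k)⁻¹ ≤ H) {W : Ω → NetVec N M} (hW4 : MemLp W 4 P) :
    fourthMoment P (fun ω => W ω - netMin wo) ≤ H * weightedMoment P wo q W :=
  (fourthMoment_le_sum (hW4.sub (memLp_const _)) hq).trans
    (mul_le_mul_of_nonneg_right hH (weightedMoment_nonneg hq W))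

/- The noise enters with a factor `C t³`, so the part of its fourth moment that grows with the error
is absorbed by half of the contraction once `C a t²` is small. -/
lemma weightedMoment_iterates_succ_le_of_small [IsProbabilityMeasure P] (hA : IsCombination net A)
    (hJ : HasHessianBounds net J wo lamL lamU) (hs : NoiseAssumption P ℱ J wo gradHat γ Rs)
    {t : ℝ} (ht : 0 < t) (ht1 : t ≤ 1) (hμ : ∀ k, 0 ≤ μ k) (hμt : ∀ k, μ k ≤ t)
    (hμU : ∀ k, μ k * lamU k ≤ 1) {q : Fin N → ℝ} (hq : ∀ k, 0 < q k) {δ Q a b : ℝ} (hδ : 0 < δ)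
    (hQ : ∑ k, q k ≤ Q)
    (contracting : ∀ l, (A *ᵥ q) l * (1 - μ l * lamL l) ≤ (1 - δ * t) * q l)
    (small : (32 / δ + 3) * Q * a * t ^ 2 ≤ δ / 4) {n : ℕ}
    (hm : StronglyMeasurable[ℱ n] (iterates net A gradHat μ W₀ n))
    (h4 : MemLp (iterates net A gradHat μ W₀ n) 4 P)
    (noise_le : fourthMoment P (noise J gradHat (n + 1) (iterates net A gradHat μ W₀ n))
      ≤ a * weightedMoment P wo q (iterates net A gradHat μ W₀ n) + b) :
    weightedMoment P wo q (iterates net A gradHat μ W₀ (n + 1))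
      ≤ (1 - δ * t / 4) * weightedMoment P wo q (iterates net A gradHat μ W₀ n)
        + (32 / δ + 3) * Q * b * t ^ 3 := by
  set C := (32 / δ + 3) * Q
  set V := weightedMoment P wo q (iterates net A gradHat μ W₀ n)
  have sum_nonneg : 0 ≤ ∑ k, q k := Finset.sum_nonneg fun k _ => (hq k).le
  have coefficient_le : (16 / (δ * t / 2) + 3) * t ^ 4 * ∑ k, q k ≤ C * t ^ 3 := by
    calc (16 / (δ * t / 2) + 3) * t ^ 4 * ∑ k, q k = (32 / δ + 3 * t) * t ^ 3 * ∑ k, q k := by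
          field_simp
          ring
      _ ≤ (32 / δ + 3 * 1) * t ^ 3 * Q := by gcongr
      _ = C * t ^ 3 := by ring
  have C_nonneg : 0 ≤ C * t ^ 3 := le_trans (by positivity) coefficient_le
  calc weightedMoment P wo q (iterates net A gradHat μ W₀ (n + 1))
      ≤ (1 - δ * t / 2) * V + (16 / (δ * t / 2) + 3) * t ^ 4 * (∑ k, q k)
        * fourthMoment P (noise J gradHat (n + 1) (iterates net A gradHat μ W₀ n)) :=
        weightedMoment_iterates_succ_le hA hJ hs hμ hμt hμU (fun k => (hq k).le)
          (mul_pos hδ ht) contracting hm h4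
    _ ≤ (1 - δ * t / 2) * V + C * t ^ 3 * (a * V + b) := by
        gcongr
        exact fourthMoment_nonneg _ _
    _ = (1 - δ * t / 2) * V + C * a * t ^ 2 * (t * V) + C * b * t ^ 3 := by ring
    _ ≤ (1 - δ * t / 2) * V + δ / 4 * (t * V) + C * b * t ^ 3 := by
        have := mul_nonneg ht.le (weightedMoment_nonneg (P := P) (wo := wo) hq
          (iterates net A gradHat μ W₀ n))
        gcongr
    _ = (1 - δ * t / 4) * V + C * b * t ^ 3 := by ring

lemma eventually_fourthMoment_iterates_le [IsProbabilityMeasure P] (hA : IsCombination net A)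
    (hJ : HasHessianBounds net J wo lamL lamU) (hs : NoiseAssumption P ℱ J wo gradHat γ Rs)
    {a b : ℝ} (ha : 0 ≤ a)
    (noise_le : ∀ (n : ℕ) (W : Ω → NetVec N M), StronglyMeasurable[ℱ n] W → MemLp W 4 P →
      fourthMoment P (noise J gradHat (n + 1) W)
        ≤ a * fourthMoment P (fun ω => W ω - netMin wo) + b)
    {t : ℝ} (ht : 0 < t) (ht1 : t ≤ 1) (hμ : ∀ k, 0 ≤ μ k) (hμt : ∀ k, μ k ≤ t)
    (hμU : ∀ k, μ k * lamU k ≤ 1) {q : Fin N → ℝ} (hq : ∀ k, 0 < q k) {δ Q H : ℝ} (hδ : 0 < δ)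
    (hδt : δ * t ≤ 1) (hQ : ∑ k, q k ≤ Q) (hH : ∑ k, (q k)⁻¹ ≤ H)
    (contracting : ∀ l, (A *ᵥ q) l * (1 - μ l * lamL l) ≤ (1 - δ * t) * q l)
    (small : (32 / δ + 3) * Q * (a * H) * t ^ 2 ≤ δ / 4)
    (hW₀ : StronglyMeasurable[ℱ 0] W₀) (hW₀4 : MemLp W₀ 4 P) :
    ∀ᶠ n in atTop, fourthMoment P (fun ω => iterates net A gradHat μ W₀ n ω - netMin wo)
      ≤ H * (4 * ((32 / δ + 3) * Q * b) / δ + 1) * t ^ 2 := by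
  set C := (32 / δ + 3) * Q
  have regular := iterates_regular hA hJ hs hμ hμU hW₀ hW₀4
  have fourthMoment_le (n : ℕ) := fourthMoment_sub_netMin_le (wo := wo) hq hH (regular n).2
  have recursion (n : ℕ) := weightedMoment_iterates_succ_le_of_small hA hJ hs ht ht1 hμ hμt hμU hq
    hδ hQ contracting small (b := b) (regular n).1 (regular n).2 <| by
      refine (noise_le n _ (regular n).1 (regular n).2).trans ?_
      rw [mul_assoc]
      gcongr
      exact fourthMoment_le n
  have limit_lt : C * b * t ^ 3 / (1 - (1 - δ * t / 4)) < (4 * (C * b) / δ + 1) * t ^ 2 := by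
    rw [show C * b * t ^ 3 / (1 - (1 - δ * t / 4)) = 4 * (C * b) / δ * t ^ 2 by
      rw [sub_sub_cancel]; field_simp]
    gcongr
    exact lt_add_one _
  have H_nonneg : 0 ≤ H := (Finset.sum_nonneg fun k _ => inv_nonneg.2 (hq k).le).trans hH
  have δt_pos : 0 < δ * t := mul_pos hδ ht
  filter_upwards [eventually_lt_of_le_mul_add
    (a := fun n => weightedMoment P wo q (iterates net A gradHat μ W₀ n))
    (by linarith) (by linarith) limit_lt (.of_forall recursion)] with n weightedMoment_lt
  exact (fourthMoment_le n).trans ((mul_le_mul_of_nonneg_left weightedMoment_lt.le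
    H_nonneg).trans_eq (mul_assoc _ _ _).symm)

theorem exists_fourthMoment_iterates_le [IsProbabilityMeasure P] (hA : IsCombination net A)
    (hp : IsPerron net A p) (hJ : HasHessianBounds net J wo lamL lamU)
    (hs : NoiseAssumption P ℱ J wo gradHat γ Rs) {τ : ℝ} (hτ : 0 < τ) :
    ∃ K : ℝ, ∀ᶠ t in 𝓝[>] (0 : ℝ), ∀ μ : Fin N → ℝ, (∀ k, τ * t ≤ μ k) → (∀ k, μ k ≤ t) →
      ∀ W₀ : Ω → NetVec N M, StronglyMeasurable[ℱ 0] W₀ → MemLp W₀ 4 P →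
        (∀ n, StronglyMeasurable[ℱ n] (iterates net A gradHat μ W₀ n) ∧
          MemLp (iterates net A gradHat μ W₀ n) 4 P) ∧
        ∀ᶠ n in atTop, fourthMoment P (fun ω => iterates net A gradHat μ W₀ n ω - netMin wo)
          ≤ K * t ^ 2 := by
  obtain ⟨a, ha, b, noise_le⟩ := hs.exists_fourthMoment_noise_le
  obtain ⟨δ, hδ, Q, H, weights⟩ := exists_contracting_weights hA hp
    (lam := fun k => τ * lamL k) (fun k => mul_nonneg hτ.le (hJ.lamL_nonneg k)) fun m =>
      (hJ.exists_lamL_pos m).imp fun _ => And.imp_right (mul_pos hτ)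
  refine ⟨H * (4 * ((32 / δ + 3) * Q * b) / δ + 1), ?_⟩
  filter_upwards [weights, self_mem_nhdsWithin,
    eventually_lt_nhdsGT_zero continuous_id one_pos,
    eventually_lt_nhdsGT_zero (f := fun t => δ * t) (by fun_prop) (by simp : _ < (1 : ℝ)),
    eventually_all.2 fun k =>
      eventually_lt_nhdsGT_zero (f := fun t => t * lamU k) (by fun_prop) (by simp : _ < (1 : ℝ)),
    eventually_lt_nhdsGT_zero (f := fun t => (32 / δ + 3) * Q * (a * H) * t ^ 2) (by fun_prop)
      (by simpa using hδ : _ < δ / 4)]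
    with t ⟨q, hq, hQ, hH, contracting⟩ (ht : 0 < t) ht1 hδt htU small μ hμτ hμt W₀ hW₀ hW₀4
  have hμ (k : Fin N) : 0 ≤ μ k := (mul_pos hτ ht).le.trans (hμτ k)
  have hμU (k : Fin N) : μ k * lamU k ≤ 1 :=
    (mul_le_mul_of_nonneg_right (hμt k) (hJ.lamU_nonneg k)).trans (htU k).le
  refine ⟨iterates_regular hA hJ hs hμ hμU hW₀ hW₀4, eventually_fourthMoment_iterates_le hA hJ hs
    ha noise_le ht ht1.le hμ hμt hμU hq hδ hδt.le hQ hH (fun l => ?_) small.le hW₀ hW₀4⟩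
  refine le_trans (mul_le_mul_of_nonneg_left ?_ (hA.mulVec_nonneg (fun k => (hq k).le) l))
    (contracting l)
  linear_combination mul_le_mul_of_nonneg_right (hμτ l) (hJ.lamL_nonneg l)

/-- The identification of `NetVec N M` with `ℝ^{NM}`, under which the second moment of the network
gradient noise is its covariance. -/
noncomputable def flatten : NetVec N M →L[ℝ] EuclideanSpace ℝ (Fin N × Fin M) :=
  (EuclideanSpace.equiv (Fin N × Fin M) ℝ).symm.toContinuousLinearMap.comp
    (ContinuousLinearMap.pi fun x =>
      (PiLp.proj 2 (fun _ : Fin M => ℝ) x.2).comp (PiLp.proj 2 (fun _ : Fin N => Vec M) x.1))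

lemma flatten_apply (s : NetVec N M) (x : Fin N × Fin M) : flatten s x = s x.1 x.2 := rfl

lemma abs_flatten_apply_le (s : NetVec N M) (x : Fin N × Fin M) : |flatten s x| ≤ ‖s‖ :=
  (PiLp.norm_apply_le (s x.1) x.2).trans (PiLp.norm_apply_le s x.1)

lemma memLp_flatten {s : Ω → NetVec N M} (hs : MemLp s 4 P) [IsFiniteMeasure P] :
    MemLp (fun ω => flatten (s ω)) 2 P :=
  flatten.comp_memLp' (hs.mono_exponent (by norm_num))

lemma integrable_condCov (n : ℕ) (W : Ω → NetVec N M) :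
    Integrable (condCov P ℱ J gradHat n W) P :=
  integrable_matrix fun _ _ => integrable_condExp

lemma integral_condCov [IsFiniteMeasure P] (n : ℕ) (W : Ω → NetVec N M) :
    ∫ ω, condCov P ℱ J gradHat n W ω ∂P
      = secondMoment P fun ω => flatten (noise J gradHat (n + 1) W ω) := by
  refine (integral_matrix fun _ _ => integrable_condExp).trans ?_
  ext x y
  exact integral_condExp (ℱ.le n)

lemma abs_condCov_apply_le [IsFiniteMeasure P] {n : ℕ} {W : Ω → NetVec N M}
    (hnoise : MemLp (noise J gradHat (n + 1) W) 4 P) (x y : Fin N × Fin M) :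
    ∀ᵐ ω ∂P, |condCov P ℱ J gradHat n W ω x y|
      ≤ 1 + (P[fun ω' => ‖noise J gradHat (n + 1) W ω'‖ ^ 4 | ℱ n]) ω := by
  set s := noise J gradHat (n + 1) W
  have product_le (ω : Ω) : ‖s ω x.1 x.2 * s ω y.1 y.2‖ ≤ 1 + ‖s ω‖ ^ 4 := by
    rw [norm_mul]
    have := mul_le_mul (abs_flatten_apply_le (s ω) x) (abs_flatten_apply_le (s ω) y)
      (abs_nonneg _) (norm_nonneg _)
    exact this.trans (by nlinarith [sq_nonneg (‖s ω‖ ^ 2 - 1)])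
  have integrable_product : Integrable (fun ω => s ω x.1 x.2 * s ω y.1 y.2) P :=
    ((memLp_flatten hnoise).eval_piLp x).integrable_mul ((memLp_flatten hnoise).eval_piLp y)
  have integrable_noise := (memLp_four_iff_integrable hnoise.1).1 hnoise
  filter_upwards [norm_condExp_le (m := ℱ n) (fun ω => s ω x.1 x.2 * s ω y.1 y.2),
    condExp_mono (m := ℱ n) integrable_product.norm ((integrable_const 1).add integrable_noise)
      (ae_of_all _ product_le),
    condExp_add (integrable_const (1 : ℝ)) integrable_noise (ℱ n)] with ω norm_le mono add_eq
  rw [condExp_const (ℱ.le n)] at add_eq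
  exact norm_le.trans (mono.trans_eq add_eq)

lemma NoiseAssumption.tendsto_condCov_netMin (hs : NoiseAssumption P ℱ J wo gradHat γ Rs) :
    ∀ᵐ ω ∂P, Tendsto (fun n => condCov P ℱ J gradHat n (fun _ => netMin wo) ω) atTop (𝓝 Rs) :=
  hs.cov_limit.mono fun _ => tendsto_iff_norm_sub_tendsto_zero.2

lemma NoiseAssumption.tendsto_secondMoment_noise_netMin [IsProbabilityMeasure P]
    (hs : NoiseAssumption P ℱ J wo gradHat γ Rs) :
    Tendsto (fun n => secondMoment P fun ω =>
      flatten (noise J gradHat (n + 1) (fun _ => netMin wo) ω)) atTop (𝓝 Rs) := by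
  obtain ⟨α, σ, -, -, hmoment⟩ := hs.fourth_moment
  have limit_entry (x y : Fin N × Fin M) : ∀ᵐ ω ∂P, Tendsto
      (fun n => condCov P ℱ J gradHat n (fun _ => netMin wo) ω x y) atTop (𝓝 (Rs x y)) :=
    hs.tendsto_condCov_netMin.mono fun ω h => tendsto_pi_nhds.1 (tendsto_pi_nhds.1 h x) y
  have entry_le (x y : Fin N × Fin M) (n : ℕ) : ∀ᵐ ω ∂P,
      ‖condCov P ℱ J gradHat n (fun _ => netMin wo) ω x y‖ ≤ 1 + σ ^ 4 := by
    have hnoise := hs.memLp_noise (n := n) stronglyMeasurable_const (memLp_const (netMin wo))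
    filter_upwards [abs_condCov_apply_le hnoise x y,
      (hmoment n _ stronglyMeasurable_const (memLp_const (netMin wo))).2] with ω entry_le noise_le
    simp only [sub_self, norm_zero, ne_eq, OfNat.ofNat_ne_zero, not_false_eq_true, zero_pow,
      mul_zero, zero_add] at noise_le
    exact entry_le.trans (by gcongr)
  refine tendsto_pi_nhds.2 fun x => tendsto_pi_nhds.2 fun y => ?_
  have limit := tendsto_integral_of_dominated_convergence (fun _ => 1 + σ ^ 4)
    (fun n => integrable_condExp.aestronglyMeasurable) (integrable_const _) (entry_le x y)
    (limit_entry x y)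
  simpa only [condCov, secondMoment, flatten_apply, Matrix.of_apply, integral_condExp (ℱ.le _),
    integral_const, probReal_univ, one_smul] using limit

lemma NoiseAssumption.exists_norm_secondMoment_noise_sub_netMin_le [IsProbabilityMeasure P]
    (hs : NoiseAssumption P ℱ J wo gradHat γ Rs) :
    ∃ κ : ℝ, 0 ≤ κ ∧ ∀ t > 0, ∀ (n : ℕ) (W : Ω → NetVec N M),
      StronglyMeasurable[ℱ n] W → MemLp W 4 P →
      ‖(secondMoment P fun ω => flatten (noise J gradHat (n + 1) (fun _ => netMin wo) ω))
          - secondMoment P fun ω => flatten (noise J gradHat (n + 1) W ω)‖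
        ≤ κ * (t ^ (γ / 2) * (1 + fourthMoment P (fun ω => W ω - netMin wo) / t ^ 2)) := by
  obtain ⟨κ, hκ, lipschitz⟩ := hs.cov_lipschitz
  refine ⟨κ, hκ, fun t ht n W hW hW4 => ?_⟩
  have integrable_error : Integrable (fun ω => ‖W ω - netMin wo‖ ^ 4) P :=
    (memLp_four_iff_integrable (hW4.sub (memLp_const _)).1).1 (hW4.sub (memLp_const _))
  have integrable_bound : Integrable
      (fun ω => κ * (t ^ (γ / 2) * (1 + ‖W ω - netMin wo‖ ^ 4 / t ^ 2))) P :=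
    (((integrable_const 1).add (integrable_error.div_const _)).const_mul _).const_mul _
  rw [← integral_condCov (ℱ := ℱ), ← integral_condCov (ℱ := ℱ),
    ← integral_sub (integrable_condCov _ _) (integrable_condCov _ _)]
  calc _ ≤ ∫ ω, κ * (t ^ (γ / 2) * (1 + ‖W ω - netMin wo‖ ^ 4 / t ^ 2)) ∂P := by
        refine norm_integral_le_of_norm_le integrable_bound ?_
        filter_upwards [lipschitz n W hW hW4] with ω hω
        rw [norm_sub_rev (netMin wo)] at hω
        exact hω.trans (mul_le_mul_of_nonneg_left (rpow_le_mul_one_add_pow_four (norm_nonneg _) ht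
          hs.cov_exponent.1.le hs.cov_exponent.2) hκ)
    _ = _ := by
        rw [integral_const_mul, integral_const_mul,
          integral_add (integrable_const _) (integrable_error.div_const _), integral_div,
          integral_const, probReal_univ, one_smul, fourthMoment]

lemma NoiseAssumption.exists_norm_secondMoment_noise_sub_le [IsProbabilityMeasure P]
    (hs : NoiseAssumption P ℱ J wo gradHat γ Rs) (K : ℝ) :
    ∃ C : ℝ, 0 < C ∧ ∀ t > 0, ∀ W : ℕ → Ω → NetVec N M,
      (∀ n, StronglyMeasurable[ℱ n] (W n) ∧ MemLp (W n) 4 P) →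
      (∀ᶠ n in atTop, fourthMoment P (fun ω => W n ω - netMin wo) ≤ K * t ^ 2) →
      ∀ᶠ n in atTop, ‖(secondMoment P fun ω => flatten (noise J gradHat (n + 1) (W n) ω)) - Rs‖
        ≤ C * t ^ (γ / 2) := by
  obtain ⟨κ, hκ, cov_le⟩ := hs.exists_norm_secondMoment_noise_sub_netMin_le
  refine ⟨κ * (1 + |K|) + 1, by positivity, fun t ht W hW hK => ?_⟩
  have near_limit := (tendsto_iff_norm_sub_tendsto_zero.1
    hs.tendsto_secondMoment_noise_netMin).eventually_le_const (Real.rpow_pos_of_pos ht (γ / 2))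
  filter_upwards [near_limit, hK] with n near_limit fourthMoment_le
  have ratio_le : fourthMoment P (fun ω => W n ω - netMin wo) / t ^ 2 ≤ |K| :=
    (div_le_iff₀ (by positivity)).2 (fourthMoment_le.trans (by gcongr; exact le_abs_self K))
  have cov_sub_le := calc
    _ ≤ _ := cov_le t ht n (W n) (hW n).1 (hW n).2
    _ ≤ κ * (t ^ (γ / 2) * (1 + |K|)) := by gcongr
  rw [norm_sub_rev] at cov_sub_le
  linarith [norm_sub_le_norm_sub_add_norm_sub
    (secondMoment P fun ω => flatten (noise J gradHat (n + 1) (W n) ω))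
    (secondMoment P fun ω => flatten (noise J gradHat (n + 1) (fun _ => netMin wo) ω)) Rs]

lemma stepMatrix_eq_diagonal : stepMatrix M μ = Matrix.diagonal fun x => μ x.1 := by
  rw [stepMatrix, ← Matrix.diagonal_one, Matrix.diagonal_kronecker_diagonal]
  simp only [mul_one]

lemma transpose_stepMatrix : (stepMatrix M μ)ᵀ = stepMatrix M μ := by
  rw [stepMatrix_eq_diagonal, Matrix.diagonal_transpose]

lemma norm_stepMatrix_le {t : ℝ} (ht : 0 ≤ t) (hμ : ∀ k, |μ k| ≤ t) : ‖stepMatrix M μ‖ ≤ t := by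
  rw [stepMatrix_eq_diagonal, Matrix.l2_opNorm_diagonal]
  exact (pi_norm_le_iff_of_nonneg ht).2 fun x => hμ x.1

lemma stepMatrix_mul_perronMatrix_mulVec (x : Fin G × Fin M → ℝ) (k : Fin N)
    (a : Fin M) :
    ((stepMatrix M μ * perronMatrix M net p) *ᵥ x) (k, a) = μ k * p k * x (net.group k, a) := by
  rw [stepMatrix_eq_diagonal]
  simp only [Matrix.mulVec, dotProduct, Matrix.diagonal_mul, perronMatrix,
    Matrix.kroneckerMap_apply, Matrix.of_apply, Matrix.one_apply, Fintype.sum_prod_type]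
  simp [mul_assoc]

lemma posDef_driving (hRs : Rs.PosDef) (hp : ∀ k, 0 < p k) (hμ : ∀ k, 0 < μ k) :
    ((perronMatrix M net p)ᵀ * stepMatrix M μ * Rs * stepMatrix M μ
      * perronMatrix M net p).PosDef := by
  have injective : Function.Injective (stepMatrix M μ * perronMatrix M net p).mulVec := by
    intro x y hxy
    funext ⟨m, a⟩
    obtain ⟨k, rfl⟩ := net.exists_group_eq m
    have agree_at_k := congrFun hxy (k, a)
    rw [stepMatrix_mul_perronMatrix_mulVec, stepMatrix_mul_perronMatrix_mulVec] at agree_at_k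
    exact mul_left_cancel₀ (mul_pos (hμ k) (hp k)).ne' agree_at_k
  have posDef := hRs.conjTranspose_mul_mul_same injective
  rwa [Matrix.conjTranspose_eq_transpose_of_trivial, Matrix.transpose_mul, transpose_stepMatrix,
    ← Matrix.mul_assoc] at posDef

lemma muMax_smul_groupHess (hμ : muMax μ ≠ 0) (m : Fin G) :
    muMax μ • groupHess net J wo p μ m
      = ∑ k with net.group k = m, (p k * μ k) • hess (J k) (wo k) := by
  rw [groupHess, Finset.smul_sum]
  refine Finset.sum_congr rfl fun k _ => ?_
  rw [smul_smul, mul_div_cancel₀ _ hμ]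

lemma HasHessianBounds.posSemidef_lowMatrix (hJ : HasHessianBounds net J wo lamL lamU)
    (hpμ : ∀ k, 0 ≤ p k * μ k) (hmax : muMax μ ≠ 0)
    (hU : ∀ m, ∑ k with net.group k = m, p k * μ k * lamU k ≤ 1) :
    (lowMatrix net J wo p μ).PosSemidef := by
  refine posSemidef_blockDiag fun m => ?_
  rw [muMax_smul_groupHess hmax]
  have posSemidef := posSemidef_sum_sub_smul_one (Finset.univ.filter fun k => net.group k = m)
    (H := fun k => -hess (J k) (wo k)) (lam := fun k => -lamU k) (c := -1) (fun k _ => hpμ k)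
    (fun k _ => by simpa [neg_add_eq_sub] using hJ.upper k (wo k))
    (by simpa using hU m)
  simpa [neg_add_eq_sub] using posSemidef

lemma HasHessianBounds.posSemidef_smul_one_sub_lowMatrix
    (hJ : HasHessianBounds net J wo lamL lamU) {c : ℝ}
    (hpμ : ∀ k, 0 ≤ p k * μ k) (hmax : muMax μ ≠ 0)
    (hL : ∀ m, c ≤ ∑ k with net.group k = m, p k * μ k * lamL k) :
    ((1 - c) • (1 : Matrix (Fin G × Fin M) (Fin G × Fin M) ℝ)
      - lowMatrix net J wo p μ).PosSemidef := by
  rw [lowMatrix, ← blockDiag_const_smul_one, ← blockDiag_sub]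
  refine posSemidef_blockDiag fun m => ?_
  rw [Pi.sub_apply, muMax_smul_groupHess hmax]
  convert posSemidef_sum_sub_smul_one (Finset.univ.filter fun k => net.group k = m)
    (fun k _ => hpμ k) (fun k _ => hJ.lower k (wo k)) (hL m) using 1
  rw [sub_smul, one_smul]
  abel

lemma HasHessianBounds.exists_forall_lt_sum_lamL (hJ : HasHessianBounds net J wo lamL lamU)
    {q : Fin N → ℝ} (hq : ∀ k, 0 < q k) :
    ∃ c > 0, ∀ m : Fin G, c < ∑ k with net.group k = m, q k * lamL k := by
  refine exists_pos_forall_lt fun m => ?_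
  obtain ⟨k, hk, hk_pos⟩ := hJ.exists_lamL_pos m
  exact Finset.sum_pos' (fun l _ => mul_nonneg (hq l).le (hJ.lamL_nonneg l))
    ⟨k, by simp [hk], mul_pos (hq k) hk_pos⟩

lemma HasHessianBounds.exists_lowMatrix_contraction (hJ : HasHessianBounds net J wo lamL lamU)
    (hp : ∀ k, 0 < p k) {τ : ℝ} (hτ : 0 < τ) :
    ∃ c > 0, ∀ᶠ t in 𝓝[>] (0 : ℝ), c * t < 1 ∧ ∀ μ : Fin N → ℝ, muMax μ = t →
      (∀ k, τ * t ≤ μ k) → (∀ k, μ k ≤ t) →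
      (lowMatrix net J wo p μ).IsSymm ∧ ‖lowMatrix net J wo p μ‖ ≤ 1 - c * t := by
  obtain ⟨c, hc, c_lt⟩ := hJ.exists_forall_lt_sum_lamL fun k => mul_pos (hp k) hτ
  refine ⟨c, hc, ?_⟩
  have small : ∀ᶠ t in 𝓝[>] (0 : ℝ), c * t < 1 :=
    eventually_lt_nhdsGT_zero (by fun_prop) (by simp)
  have upper_small : ∀ᶠ t in 𝓝[>] (0 : ℝ), ∀ m : Fin G,
      t * ∑ k with net.group k = m, p k * lamU k < 1 :=
    eventually_all.2 fun m => eventually_lt_nhdsGT_zero (by fun_prop) (by simp)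
  filter_upwards [small, upper_small, self_mem_nhdsWithin] with t small upper_small (ht : 0 < t)
  refine ⟨small, fun μ hmax hμ hμt => ?_⟩
  have hmax_ne : muMax μ ≠ 0 := hmax ▸ ht.ne'
  have hpμ (k : Fin N) : 0 ≤ p k * μ k := mul_nonneg (hp k).le ((mul_pos hτ ht).le.trans (hμ k))
  have posSemidef := hJ.posSemidef_lowMatrix hpμ hmax_ne fun m => by
    refine le_trans ?_ (upper_small m).le
    rw [Finset.mul_sum]
    refine Finset.sum_le_sum fun k _ => ?_
    rw [← mul_assoc, mul_comm t]
    have := (hp k).le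
    have := hJ.lamU_nonneg k
    gcongr
    exact hμt k
  have upper := hJ.posSemidef_smul_one_sub_lowMatrix (c := c * t) hpμ hmax_ne fun m => by
    refine (mul_le_mul_of_nonneg_right (c_lt m).le ht.le).trans ?_
    rw [Finset.sum_mul]
    refine Finset.sum_le_sum fun k _ => ?_
    rw [mul_right_comm, mul_assoc (p k)]
    have := (hp k).le
    have := hJ.lamL_nonneg k
    gcongr
    exact hμ k
  exact ⟨Matrix.isHermitian_iff_isSymm.1 posSemidef.1,
    l2_opNorm_le_of_posSemidef (by linarith) posSemidef upper⟩

lemma lowError_regular [IsProbabilityMeasure P] (hs : NoiseAssumption P ℱ J wo gradHat γ Rs)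
    (hW : ∀ n, StronglyMeasurable[ℱ n] (iterates net A gradHat μ W₀ n) ∧
      MemLp (iterates net A gradHat μ W₀ n) 4 P)
    (hX₀ : StronglyMeasurable[ℱ 0] X₀) (hX₀2 : MemLp X₀ 2 P) (n : ℕ) :
    StronglyMeasurable[ℱ n] (lowError net A J wo gradHat p μ W₀ X₀ n) ∧
      MemLp (lowError net A J wo gradHat p μ W₀ X₀ n) 2 P := by
  induction n with
  | zero => exact ⟨hX₀, hX₀2⟩
  | succ n ih =>
    obtain ⟨measurable, memLp⟩ := ih
    have noise_measurable := hs.adapted n _ (hW n).1 (hW n).2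
    have noise_memLp := memLp_flatten (hs.memLp_noise (hW n).1 (hW n).2)
    constructor
    · exact (stronglyMeasurable_mulVec (measurable.mono (ℱ.mono n.le_succ))
        (lowMatrix net J wo p μ)).add
        (stronglyMeasurable_mulVec (flatten.continuous.comp_stronglyMeasurable noise_measurable)
          ((perronMatrix M net p)ᵀ * stepMatrix M μ))
    · exact (memLp_mulVec memLp (lowMatrix net J wo p μ)).add
        (memLp_mulVec noise_memLp ((perronMatrix M net p)ᵀ * stepMatrix M μ))

lemma crossMoment_lowError_noise [IsProbabilityMeasure P]
    (hs : NoiseAssumption P ℱ J wo gradHat γ Rs)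
    {W : Ω → NetVec N M} {X : Ω → EuclideanSpace ℝ (Fin G × Fin M)} {n : ℕ}
    (hW : StronglyMeasurable[ℱ n] W) (hW4 : MemLp W 4 P)
    (hX : StronglyMeasurable[ℱ n] X) (hX2 : MemLp X 2 P) :
    crossMoment P X (fun ω => flatten (noise J gradHat (n + 1) W ω)) = 0 := by
  have noise_memLp := hs.memLp_noise hW hW4
  ext x y
  exact integral_bilin_eq_zero_of_condExp_eq_zero (ℱ.le n) (ContinuousLinearMap.mul ℝ ℝ)
    (stronglyMeasurable_piLp_apply hX x)
    ((hX2.eval_piLp x).integrable_mul ((memLp_flatten noise_memLp).eval_piLp y))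
    (((memLp_flatten noise_memLp).eval_piLp y).integrable (by norm_num))
    (condExp_clm_comp_eq_zero (noise_memLp.integrable (by norm_num))
      (hs.martingale_diff n _ hW hW4) ((PiLp.proj 2 (fun _ => ℝ) y).comp flatten))

lemma secondMoment_lowError_succ [IsProbabilityMeasure P]
    (hs : NoiseAssumption P ℱ J wo gradHat γ Rs)
    (hW : ∀ n, StronglyMeasurable[ℱ n] (iterates net A gradHat μ W₀ n) ∧
      MemLp (iterates net A gradHat μ W₀ n) 4 P)
    (hX₀ : StronglyMeasurable[ℱ 0] X₀) (hX₀2 : MemLp X₀ 2 P) (n : ℕ) :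
    secondMoment P (lowError net A J wo gradHat p μ W₀ X₀ (n + 1))
      = lowMatrix net J wo p μ * secondMoment P (lowError net A J wo gradHat p μ W₀ X₀ n)
          * (lowMatrix net J wo p μ)ᵀ
        + ((perronMatrix M net p)ᵀ * stepMatrix M μ)
          * (secondMoment P fun ω =>
              flatten (noise J gradHat (n + 1) (iterates net A gradHat μ W₀ n) ω))
          * ((perronMatrix M net p)ᵀ * stepMatrix M μ)ᵀ := by
  obtain ⟨measurable, memLp⟩ := lowError_regular (p := p) hs hW hX₀ hX₀2 n
  exact secondMoment_mulVec_add_mulVec memLp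
    (memLp_flatten (hs.memLp_noise (hW n).1 (hW n).2))
    (crossMoment_lowError_noise hs (hW n).1 (hW n).2 measurable memLp) _ _

/- Subtracting the Lyapunov equation from the recursion of the second moments leaves a contraction
driven by the deviation of the noise covariance from `Rs`. -/
lemma norm_secondMoment_lowError_succ_sub_le [IsProbabilityMeasure P]
    (hs : NoiseAssumption P ℱ J wo gradHat γ Rs)
    (hW : ∀ n, StronglyMeasurable[ℱ n] (iterates net A gradHat μ W₀ n) ∧
      MemLp (iterates net A gradHat μ W₀ n) 4 P)
    (hX₀ : StronglyMeasurable[ℱ 0] X₀) (hX₀2 : MemLp X₀ 2 P)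
    {t : ℝ} (ht : 0 ≤ t) (hμ : ∀ k, |μ k| ≤ t) (hD : (lowMatrix net J wo p μ).IsSymm)
    {Θ : Matrix (Fin G × Fin M) (Fin G × Fin M) ℝ} (hΘ : IsLyapunov net J wo p μ Rs Θ) (n : ℕ) :
    ‖secondMoment P (lowError net A J wo gradHat p μ W₀ X₀ (n + 1)) - Θ‖
      ≤ ‖lowMatrix net J wo p μ‖ ^ 2
          * ‖secondMoment P (lowError net A J wo gradHat p μ W₀ X₀ n) - Θ‖
        + (‖perronMatrix M net p‖ * t) ^ 2
          * ‖(secondMoment P fun ω =>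
              flatten (noise J gradHat (n + 1) (iterates net A gradHat μ W₀ n) ω)) - Rs‖ := by
  set D := lowMatrix net J wo p μ
  set B := (perronMatrix M net p)ᵀ * stepMatrix M μ with B_def
  set S := secondMoment P (lowError net A J wo gradHat p μ W₀ X₀ n)
  set R := secondMoment P fun ω =>
    flatten (noise J gradHat (n + 1) (iterates net A gradHat μ W₀ n) ω)
  have norm_B_le : ‖B‖ ≤ ‖perronMatrix M net p‖ * t := by
    refine (Matrix.l2_opNorm_mul _ _).trans ?_
    rw [l2_opNorm_transpose]
    exact mul_le_mul_of_nonneg_left (norm_stepMatrix_le ht hμ) (norm_nonneg _)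
  have lyapunov : Θ = D * Θ * Dᵀ + B * Rs * Bᵀ := by
    rw [hD.eq, B_def, Matrix.transpose_mul, transpose_stepMatrix, Matrix.transpose_transpose,
      ← Matrix.mul_assoc]
    exact hΘ
  have difference : secondMoment P (lowError net A J wo gradHat p μ W₀ X₀ (n + 1)) - Θ
      = D * (S - Θ) * Dᵀ + B * (R - Rs) * Bᵀ := by
    rw [secondMoment_lowError_succ hs hW hX₀ hX₀2 n]
    nth_rewrite 1 [lyapunov]
    simp only [Matrix.mul_sub, Matrix.sub_mul]
    abel
  rw [difference]
  refine (norm_add_le _ _).trans (add_le_add (norm_mul_mul_transpose_le _ _) ?_)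
  exact (norm_mul_mul_transpose_le _ _).trans (by gcongr)

lemma eventually_norm_secondMoment_lowError_sub_lt [IsProbabilityMeasure P]
    (hs : NoiseAssumption P ℱ J wo gradHat γ Rs)
    (hW : ∀ n, StronglyMeasurable[ℱ n] (iterates net A gradHat μ W₀ n) ∧
      MemLp (iterates net A gradHat μ W₀ n) 4 P)
    (hX₀ : StronglyMeasurable[ℱ 0] X₀) (hX₀2 : MemLp X₀ 2 P)
    {c t b : ℝ} (hc : 0 < c) (ht : 0 < t) (hct : c * t < 1) (hb : 0 < b)
    (hμ : ∀ k, |μ k| ≤ t) (hD : (lowMatrix net J wo p μ).IsSymm)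
    (hD_norm : ‖lowMatrix net J wo p μ‖ ≤ 1 - c * t)
    {Θ : Matrix (Fin G × Fin M) (Fin G × Fin M) ℝ} (hΘ : IsLyapunov net J wo p μ Rs Θ)
    (hcov : ∀ᶠ n in atTop, ‖(secondMoment P fun ω =>
      flatten (noise J gradHat (n + 1) (iterates net A gradHat μ W₀ n) ω)) - Rs‖ ≤ b) :
    ∀ᶠ n in atTop, ‖secondMoment P (lowError net A J wo gradHat p μ W₀ X₀ n) - Θ‖
      < (‖perronMatrix M net p‖ ^ 2 + 1) / c * (t * b) := by
  have norm_sq_le : ‖lowMatrix net J wo p μ‖ ^ 2 ≤ 1 - c * t := by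
    have := pow_le_pow_left₀ (norm_nonneg _) hD_norm 2
    nlinarith [mul_pos hc ht]
  refine eventually_lt_of_le_mul_add (ρ := 1 - c * t)
    (b := (‖perronMatrix M net p‖ * t) ^ 2 * b) (by linarith) (by linarith [mul_pos hc ht]) ?_ ?_
  · have : 0 < t * b / c := by positivity
    calc _ = ‖perronMatrix M net p‖ ^ 2 * (t * b / c) := by
          rw [sub_sub_cancel]
          field_simp
      _ < (‖perronMatrix M net p‖ ^ 2 + 1) * (t * b / c) := by gcongr; linarith
      _ = _ := by ring
  · filter_upwards [hcov] with n cov_le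
    refine (norm_secondMoment_lowError_succ_sub_le hs hW hX₀ hX₀2 ht.le hμ hD hΘ n).trans ?_
    gcongr

lemma eventually_secondMoment_lowError_approx [IsProbabilityMeasure P] (hA : IsCombination net A)
    (hp : IsPerron net A p) (hJ : HasHessianBounds net J wo lamL lamU)
    (hs : NoiseAssumption P ℱ J wo gradHat γ Rs) {τ : ℝ} (hτ : 0 < τ) :
    ∃ C, 0 ≤ C ∧ ∀ᶠ t in 𝓝[>] (0 : ℝ), ∀ μ : Fin N → ℝ, muMax μ = t → (∀ k, τ * t ≤ μ k) →
      (∀ k, μ k ≤ t) → (lowMatrix net J wo p μ).IsSymm ∧ ‖lowMatrix net J wo p μ‖ < 1 ∧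
      ∀ Θ, IsLyapunov net J wo p μ Rs Θ →
        ∀ (W₀ : Ω → NetVec N M) (X₀ : Ω → EuclideanSpace ℝ (Fin G × Fin M)),
          StronglyMeasurable[ℱ 0] W₀ → MemLp W₀ 4 P → StronglyMeasurable[ℱ 0] X₀ →
          MemLp X₀ 2 P →
          (∀ i, MemLp (lowError net A J wo gradHat p μ W₀ X₀ i) 2 P) ∧
          ∀ᶠ i in atTop, ‖secondMoment P (lowError net A J wo gradHat p μ W₀ X₀ i) - Θ‖
            ≤ C * t ^ (1 + γ / 2) := by
  obtain ⟨K, iterates_bound⟩ := exists_fourthMoment_iterates_le hA hp hJ hs hτ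
  obtain ⟨b, hb, covariance_bound⟩ := hs.exists_norm_secondMoment_noise_sub_le K
  obtain ⟨c, hc, contraction⟩ := hJ.exists_lowMatrix_contraction (hp.pos hA) hτ
  refine ⟨(‖perronMatrix M net p‖ ^ 2 + 1) / c * b, by positivity, ?_⟩
  filter_upwards [iterates_bound, contraction, self_mem_nhdsWithin]
    with t iterates_bound ⟨hct, contraction⟩ (ht : 0 < t) μ hmax hτμ hμt
  obtain ⟨hD, hD_norm⟩ := contraction μ hmax hτμ hμt
  refine ⟨hD, hD_norm.trans_lt (by linarith [mul_pos hc ht]),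
    fun Θ hΘ W₀ X₀ hW₀ hW₀4 hX₀ hX₀2 => ?_⟩
  obtain ⟨regular, moment_le⟩ := iterates_bound μ hτμ hμt W₀ hW₀ hW₀4
  have abs_le (k : Fin N) : |μ k| ≤ t :=
    (abs_of_nonneg ((mul_pos hτ ht).le.trans (hτμ k))).trans_le (hμt k)
  refine ⟨fun i => (lowError_regular hs regular hX₀ hX₀2 i).2, ?_⟩
  filter_upwards [eventually_norm_secondMoment_lowError_sub_lt hs regular hX₀ hX₀2 hc ht hct
    (by positivity) abs_le hD hD_norm hΘ (covariance_bound t ht _ regular moment_le)] with i h_lt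
  refine h_lt.le.trans_eq ?_
  rw [Real.rpow_add ht, Real.rpow_one]
  ring

theorem exists_secondMoment_lowError_approx [IsProbabilityMeasure P] (hA : IsCombination net A)
    (hp : IsPerron net A p) (hJ : HasHessianBounds net J wo lamL lamU)
    (hs : NoiseAssumption P ℱ J wo gradHat γ Rs) {τ : ℝ} (hτ : 0 < τ) :
    ∃ μ₀ : ℝ, 0 < μ₀ ∧ ∃ C : ℝ, 0 ≤ C ∧ ∀ μ : Fin N → ℝ, (∀ k, 0 < μ k) →
      (∀ k, τ * muMax μ ≤ μ k) → muMax μ ≤ μ₀ →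
      (lowMatrix net J wo p μ).IsSymm ∧ ‖lowMatrix net J wo p μ‖ < 1 ∧
      ∀ Θ, IsLyapunov net J wo p μ Rs Θ →
        ∀ (W₀ : Ω → NetVec N M) (X₀ : Ω → EuclideanSpace ℝ (Fin G × Fin M)),
          StronglyMeasurable[ℱ 0] W₀ → MemLp W₀ 4 P → StronglyMeasurable[ℱ 0] X₀ →
          MemLp X₀ 2 P →
          (∀ i, MemLp (lowError net A J wo gradHat p μ W₀ X₀ i) 2 P) ∧
          ∀ᶠ i in atTop, ‖secondMoment P (lowError net A J wo gradHat p μ W₀ X₀ i) - Θ‖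
            ≤ C * muMax μ ^ (1 + γ / 2) := by
  obtain ⟨C, hC, small_steps⟩ := eventually_secondMoment_lowError_approx hA hp hJ hs hτ
  obtain ⟨μ₀, hμ₀, bound⟩ := mem_nhdsGT_iff_exists_Ioc_subset.1 small_steps
  refine ⟨μ₀, hμ₀, C, hC, fun μ hμ hτμ hmax => ?_⟩
  have le_muMax (k : Fin N) : μ k ≤ muMax μ := le_ciSup (Set.finite_range μ).bddAbove k
  rcases isEmpty_or_nonempty (Fin N) with _ | ⟨⟨k⟩⟩
  · have : IsEmpty (Fin G) := ⟨fun m => isEmptyElim (net.exists_group_eq m).choose⟩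
    have muMax_eq_zero : muMax μ = 0 := Real.iSup_of_isEmpty μ
    refine ⟨Subsingleton.elim _ _, by simp [Subsingleton.elim (lowMatrix net J wo p μ) 0],
      fun Θ _ W₀ X₀ _ _ _ _ => ⟨fun i => ?_, .of_forall fun i => ?_⟩⟩
    · rw [Subsingleton.elim (lowError net A J wo gradHat p μ W₀ X₀ i) 0]
      exact MemLp.zero
    · rw [Subsingleton.elim (_ - Θ) 0, norm_zero, muMax_eq_zero]
      positivity
  · exact bound ⟨(hμ k).trans_le (le_muMax k), hmax⟩ μ rfl hτμ le_muMax

end Diffusion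

end DiffusionNet

theorem mainTheorem8_general {N G M : ℕ} {Ω : Type*} {mΩ : MeasurableSpace Ω}
    (P : Measure Ω) [IsProbabilityMeasure P] (ℱ : Filtration ℕ mΩ)
    (net : DiffusionNet.Network N G)
    (A : Matrix (Fin N) (Fin N) ℝ) (hA : DiffusionNet.IsCombination net A)
    (p : Fin N → ℝ) (hp : DiffusionNet.IsPerron net A p)
    (J : Fin N → DiffusionNet.Vec M → ℝ) (wo : Fin N → DiffusionNet.Vec M)
    (lamL lamU : Fin N → ℝ) (hJ : DiffusionNet.HasHessianBounds net J wo lamL lamU)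
    (gradHat : Fin N → ℕ → Ω → DiffusionNet.Vec M → DiffusionNet.Vec M)
    (γ : ℝ) (Rs : Matrix (Fin N × Fin M) (Fin N × Fin M) ℝ)
    (hs : DiffusionNet.NoiseAssumption P ℱ J wo gradHat γ Rs)
    (τ : ℝ) (hτ : 0 < τ) :
    ∃ μ₀ : ℝ, 0 < μ₀ ∧ ∃ C : ℝ, 0 ≤ C ∧
      ∀ μ : Fin N → ℝ, (∀ k, 0 < μ k) → (∀ k, τ * DiffusionNet.muMax μ ≤ μ k) →
        DiffusionNet.muMax μ ≤ μ₀ →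
        ∃ Θ : Matrix (Fin G × Fin M) (Fin G × Fin M) ℝ,
          Θ.IsSymm ∧ Θ.PosDef ∧
          DiffusionNet.IsLyapunov net J wo p μ Rs Θ ∧
          (∀ Θ', DiffusionNet.IsLyapunov net J wo p μ Rs Θ' → Θ' = Θ) ∧
          ∀ (W₀ : Ω → DiffusionNet.NetVec N M) (X₀ : Ω → EuclideanSpace ℝ (Fin G × Fin M)),
            StronglyMeasurable[ℱ 0] W₀ → MemLp W₀ 4 P →
            StronglyMeasurable[ℱ 0] X₀ → MemLp X₀ 2 P →
            (∀ i, MemLp (DiffusionNet.lowError net A J wo gradHat p μ W₀ X₀ i) 2 P) ∧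
            limsup (fun i => ENNReal.ofReal
                ‖DiffusionNet.secondMoment P
                    (DiffusionNet.lowError net A J wo gradHat p μ W₀ X₀ i) - Θ‖) atTop
              ≤ ENNReal.ofReal (C * DiffusionNet.muMax μ ^ (1 + γ / 2)) := by
  obtain ⟨μ₀, hμ₀, C, hC, bound⟩ :=
    DiffusionNet.exists_secondMoment_lowError_approx hA hp hJ hs hτ
  refine ⟨μ₀, hμ₀, C, hC, fun μ hμ hτμ hmax => ?_⟩
  obtain ⟨hD, hD_norm, approx⟩ := bound μ hμ hτμ hmax
  have driving_posDef := DiffusionNet.posDef_driving (net := net) hs.cov_posDef (hp.pos hA) hμ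
  have existsUnique : ∃! Θ, DiffusionNet.IsLyapunov net J wo p μ Rs Θ :=
    DiffusionNet.existsUnique_stein hD_norm _
  obtain ⟨Θ, hΘ, unique⟩ := existsUnique
  have posDef := DiffusionNet.posDef_of_stein hD_norm hD driving_posDef hΘ
  refine ⟨Θ, Matrix.isHermitian_iff_isSymm.1 posDef.1, posDef, hΘ, unique,
    fun W₀ X₀ hW₀ hW₀4 hX₀ hX₀2 => ?_⟩
  obtain ⟨memLp, eventually_le⟩ := approx Θ hΘ W₀ X₀ hW₀ hW₀4 hX₀ hX₀2
  exact ⟨memLp, limsup_le_of_le (by isBoundedDefault)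
    (eventually_le.mono fun _ => ENNReal.ofReal_le_ofReal)⟩

theorem mainTheorem8 {N G M : ℕ} {Ω : Type*} {mΩ : MeasurableSpace Ω}
    (P : Measure Ω) [IsProbabilityMeasure P] (ℱ : Filtration ℕ mΩ)
    (net : DiffusionNet.Network N G)
    (A : Matrix (Fin N) (Fin N) ℝ) (hA : DiffusionNet.IsCombination net A)
    (p : Fin N → ℝ) (hp : DiffusionNet.IsPerron net A p)
    (J : Fin N → DiffusionNet.Vec M → ℝ) (wo : Fin N → DiffusionNet.Vec M)
    (hJ : DiffusionNet.CostAssumption net J wo)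
    (gradHat : Fin N → ℕ → Ω → DiffusionNet.Vec M → DiffusionNet.Vec M)
    (γ : ℝ) (Rs : Matrix (Fin N × Fin M) (Fin N × Fin M) ℝ)
    (hs : DiffusionNet.NoiseAssumption P ℱ J wo gradHat γ Rs)
    (τ : ℝ) (hτ : 0 < τ) :
    ∃ μ₀ : ℝ, 0 < μ₀ ∧ ∃ C : ℝ, 0 ≤ C ∧
      ∀ μ : Fin N → ℝ, (∀ k, 0 < μ k) → (∀ k, τ * DiffusionNet.muMax μ ≤ μ k) →
        DiffusionNet.muMax μ ≤ μ₀ →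
        ∃ Θ : Matrix (Fin G × Fin M) (Fin G × Fin M) ℝ,
          Θ.IsSymm ∧ Θ.PosDef ∧
          DiffusionNet.IsLyapunov net J wo p μ Rs Θ ∧
          (∀ Θ', DiffusionNet.IsLyapunov net J wo p μ Rs Θ' → Θ' = Θ) ∧
          ∀ (W₀ : Ω → DiffusionNet.NetVec N M) (X₀ : Ω → EuclideanSpace ℝ (Fin G × Fin M)),
            StronglyMeasurable[ℱ 0] W₀ → MemLp W₀ 4 P →
            StronglyMeasurable[ℱ 0] X₀ → MemLp X₀ 2 P →
            (∀ i, MemLp (DiffusionNet.lowError net A J wo gradHat p μ W₀ X₀ i) 2 P) ∧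
            limsup (fun i => ENNReal.ofReal
                ‖DiffusionNet.secondMoment P
                    (DiffusionNet.lowError net A J wo gradHat p μ W₀ X₀ i) - Θ‖) atTop
              ≤ ENNReal.ofReal (C * DiffusionNet.muMax μ ^ (1 + γ / 2)) := by
  obtain ⟨lamL, lamU, hJ⟩ := hJ.exists_hasHessianBounds
  exact mainTheorem8_general P ℱ net A hA p hp J wo lamL lamU hJ gradHat γ Rs hs τ hτ
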